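/- **Theorem 4.3 (equivalence of metric regularity and strong metric regularity).** *Conventions.* For $\Omega\subset\mathbb R^d$ and $x\in\Omega$, the tangent cone $T_\Omega(x)$ is the set of limits of sequences $w_k$ for which there are $t_k\searrow 0$ with $x+t_kw_k\in\Omega$; $\widehat N_\Omega(x)=\{v\mid\langle v,w\rangle\le 0\ \forall w\in T_\Omega(x)\}$ is the regular normal cone; the limiting normal cone $N_\Omega(x)$ consists of all limits of sequences $v_k\in\widehat N_\Omega(x_k)$ with $\Omega\ni x_k\to x$. For $\varphi:\mathbb R^n\to[-\infty,\infty]$ finite at $x$, $\partial\varphi(x)=\{v\mid (v,-1)\in N_{\mathrm{epi}\,\varphi}(x,\varphi(x))\}$ (and $\partial\varphi(x)=\emptyset$ where $\varphi$ is not finite), the subderivative is $\mathrm d\varphi(x)(w)=\liminf_{t\searrow0,\,w'\to w}\frac{\varphi(x+tw')-\varphi(x)}{t}$, and for $v\in\partial\varphi(x)$ the critical cone is $K_\varphi(x,v)=\{w\mid\langle v,w\rangle=\mathrm d\varphi(x)(w)\}$. For a set-valued mapping $F$ and $(x,y)\in\mathrm{gph}\,F$, the graphical derivative is given by $z\in DF(x,y)(w)\iff(w,z)\in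 T_{\mathrm{gph}\,F}(x,y)$ and the coderivative by $w\in D^*F(x,y)(u)\iff(w,-u)\in N_{\mathrm{gph}\,F}(x,y)$. $F$ is *metrically regular* at $\bar x$ for $\bar y\in F(\bar x)$ if there are $\kappa\ge0$ and neighborhoods $U$ of $\bar x$, $V$ of $\bar y$ with $\mathrm{dist}(x,F^{-1}(y))\le\kappa\,\mathrm{dist}(y,F(x))$ for all $(x,y)\in U\times V$ (with $\mathrm{dist}(\cdot,\emptyset)=\infty$). A mapping $S$ has a *Lipschitz continuous localization* $\sigma$ around $\bar u$ for $\bar x\in S(\bar u)$ if there are neighborhoods $V$ of $\bar u$ and $U$ of $\bar x$ such that $S(u)\cap U=\{\sigma(u)\}$ for all $u\in V$ and $\sigma$ is Lipschitz continuous on $V$. $F$ is *strongly metrically regular* at $\bar x$ for $\bar y$ if $F^{-1}$ has a Lipschitz continuous localization around $\bar y$ for $\bar x$. *Setting.* Let $f:\mathbb R^n\to\mathbb R^n$ be $\mathcal C^1$, and let $\varphi:\mathbb R^n\to[-\infty,\infty]$ satisfy $\varphi=g\circ\Phi$ on a neighborhood of $\bar x\in\mathbb R^n$, where $\Phi:\mathbb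 R^n\to\mathbb R^m$ is twice continuously differentiable around $\bar x$ and $g:\mathbb R^m\to[-\infty,\infty]$ is polyhedral, i.e. proper with polyhedral convex epigraph. Set $G(x)=f(x)+\partial\varphi(x)$ and $S=G^{-1}$. Let $\bar u\in\mathbb R^n$ and let $\bar x$ be a nondegenerate solution of $\bar u\in f(x)+\partial\varphi(x)$, that is, $$\bar u-f(\bar x)\in\mathrm{ri}\,\partial\varphi(\bar x).$$ Let $\bar\lambda$ belong to $\Lambda:=\{\lambda\in\partial g(\Phi(\bar x))\mid\nabla\Phi(\bar x)^*\lambda=\bar u-f(\bar x)\}$ and assume that the second-order qualification condition (SOQC) holds at $(\bar x,\bar\lambda)$: $$D^*(\partial g)(\Phi(\bar x),\bar\lambda)(0)\cap\ker\nabla\Phi(\bar x)^*=\{0\}.$$ Put $\overline K:=K_\varphi(\bar x,\bar u-f(\bar x))$ and $A:=\nabla f(\bar x)+\nabla^2\langle\bar\lambda,\Phi\rangle(\bar x)$. *Conclusion.* $\Lambda=\{\bar\lambda\}$, $\overline K$ is a linear subspace of $\mathbb R^n$, and the following hold. (a) $G$ is metrically regular at $\bar x$ for $\bar u$ if and only if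 it is strongly metrically regular at $\bar x$ for $\bar u$. (b) The following properties are equivalent: 1. $G$ is metrically regular at $\bar x$ for $\bar u$; 2. $\{w\in\mathbb R^n\mid A^*w\in\overline K^\perp\}\cap\overline K=\{0\}$; 3. $A\overline K+\overline K^\perp=\mathbb R^n$; 4. $DG(\bar x,\bar u)$ is surjective; 5. $S$ has a Lipschitz continuous localization $\sigma$ around $\bar u$ for $\bar x$ that is $\mathcal C^1$ in a neighborhood of $\bar u$ and satisfies, for every matrix $B\in\mathbb R^{n\times s}$ ($s=\dim\overline K$) whose columns form a basis of $\overline K$, that $B^*AB$ is nonsingular and $$\nabla\sigma(\bar u)=B(B^*AB)^{-1}B^*.$$ Moreover, every Lipschitz continuous localization $\sigma$ of $S$ around $\bar u$ for $\bar x$ is $\mathcal C^1$ in a neighborhood of $\bar u$ and satisfies this formula for every such $B$. -/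

import Mathlib

open Set Filter Topology Metric
open scoped NNReal ENNReal Pointwise

noncomputable section

namespace VarAn

section Cones

variable {H : Type*} [NormedAddCommGroup H] [InnerProductSpace ℝ H]

/-- The polar cone `C* = {v | ⟨v, w⟩ ≤ 0 for all w ∈ C}`. -/
def polar (C : Set H) : Set H :=
  {v | ∀ w ∈ C, inner ℝ v w ≤ 0}

/-- The orthogonal complement of a set. -/
def perp (C : Set H) : Set H :=
  {v | ∀ w ∈ C, inner ℝ v w = 0}

/-- The (Bouligand) tangent cone: the outer limit of `(Ω - x) / t` as `t ↘ 0`. -/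
def tangentCone (Ω : Set H) (x : H) : Set H :=
  {w | ∃ (t : ℕ → ℝ) (z : ℕ → H), (∀ k, 0 < t k) ∧ Tendsto t atTop (𝓝 0) ∧
    Tendsto z atTop (𝓝 w) ∧ ∀ k, x + t k • z k ∈ Ω}

/-- The regular (Fréchet) normal cone: the polar of the tangent cone. -/
def regNormalCone (Ω : Set H) (x : H) : Set H :=
  polar (tangentCone Ω x)

/-- The limiting (Mordukhovich) normal cone. -/
def normalCone (Ω : Set H) (x : H) : Set H :=
  {v | ∃ (z : ℕ → H) (y : ℕ → H), (∀ k, z k ∈ Ω) ∧ (∀ k, y k ∈ regNormalCone Ω (z k)) ∧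
    Tendsto z atTop (𝓝 x) ∧ Tendsto y atTop (𝓝 v)}

/-- A polyhedral convex set: a finite intersection of closed half-spaces. -/
def IsPolyhedral (C : Set H) : Prop :=
  ∃ (k : ℕ) (a : Fin k → H) (b : Fin k → ℝ), C = {x | ∀ i, inner ℝ (a i) x ≤ b i}

/-- The epigraph, as a subset of the Euclidean product `H × ℝ`. -/
def epi (φ : H → EReal) : Set (WithLp 2 (H × ℝ)) :=
  {p | φ p.fst ≤ (p.snd : EReal)}

/-- A proper function with polyhedral epigraph. -/
structure IsPolyhedralFun (g : H → EReal) : Prop where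
  ne_bot : ∀ z, g z ≠ ⊥
  exists_ne_top : ∃ z, g z ≠ ⊤
  polyhedral_epi : IsPolyhedral (epi g)

/-- The limiting subdifferential; it is empty where `φ` is not finite. -/
def subdiff (φ : H → EReal) (x : H) : Set H :=
  {v | φ x ≠ ⊤ ∧ φ x ≠ ⊥ ∧
    WithLp.toLp 2 (v, (-1 : ℝ)) ∈ normalCone (epi φ) (WithLp.toLp 2 (x, (φ x).toReal))}

/-- The subderivative `dφ(x)(w)`: the lower limit of `(φ(x + t w') - φ(x)) / t`
as `t ↘ 0` and `w' → w`. -/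
def subderiv (φ : H → EReal) (x w : H) : EReal :=
  liminf (fun p : ℝ × H => (φ (x + p.1 • p.2) - φ x) / (p.1 : EReal)) (𝓝[>] 0 ×ˢ 𝓝 w)

/-- The critical cone of `φ` at `x` for `v`. -/
def criticalCone (φ : H → EReal) (x v : H) : Set H :=
  {w | ((inner ℝ v w : ℝ) : EReal) = subderiv φ x w}

end Cones

section Mappings

variable {X Y : Type*} [NormedAddCommGroup X] [InnerProductSpace ℝ X]
  [NormedAddCommGroup Y] [InnerProductSpace ℝ Y]

/-- The graph of a set-valued mapping, as a subset of the Euclidean product `X × Y`. -/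
def gph (F : X → Set Y) : Set (WithLp 2 (X × Y)) :=
  {p | p.snd ∈ F p.fst}

/-- The inverse of a set-valued mapping. -/
def setInv (F : X → Set Y) (y : Y) : Set X :=
  {x | y ∈ F x}

/-- The graphical derivative `DF(x, y)(w)`. -/
def graphDeriv (F : X → Set Y) (x : X) (y : Y) (w : X) : Set Y :=
  {z | WithLp.toLp 2 (w, z) ∈ tangentCone (gph F) (WithLp.toLp 2 (x, y))}

/-- The coderivative `D*F(x, y)(u)`. -/
def coderiv (F : X → Set Y) (x : X) (y : Y) (u : Y) : Set X :=
  {w | WithLp.toLp 2 (w, -u) ∈ normalCone (gph F) (WithLp.toLp 2 (x, y))}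

/-- Metric regularity of `F` at `x` for `y`. Distances are extended, so that the distance
to the empty set is `∞`. -/
def MetricallyRegular (F : X → Set Y) (x : X) (y : Y) : Prop :=
  y ∈ F x ∧ ∃ κ : ℝ≥0, ∃ U ∈ 𝓝 x, ∃ V ∈ 𝓝 y, ∀ x' ∈ U, ∀ y' ∈ V,
    infEDist x' (setInv F y') ≤ (κ : ℝ≥0∞) * infEDist y' (F x')

/-- `σ` is a Lipschitz continuous single-valued localization of `S` around `u` for `x`
(only the values of `σ` near `u` matter). -/
def IsLipschitzLocalization (S : Y → Set X) (u : Y) (x : X) (σ : Y → X) : Prop :=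
  x ∈ S u ∧ ∃ U ∈ 𝓝 x, ∃ V ∈ 𝓝 u,
    (∀ u' ∈ V, S u' ∩ U = {σ u'}) ∧ ∃ L : ℝ≥0, LipschitzOnWith L σ V

/-- Strong metric regularity of `F` at `x` for `y`. -/
def StronglyMetricallyRegular (F : X → Set Y) (x : X) (y : Y) : Prop :=
  ∃ σ : Y → X, IsLipschitzLocalization (setInv F) y x σ

end Mappings

section Composite

variable {n m : ℕ}

/-- The Lagrange multiplier set `Λ(x, v)` of the composition `g ∘ Φ`. -/
def multipliers (g : EuclideanSpace ℝ (Fin m) → EReal)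
    (Φ : EuclideanSpace ℝ (Fin n) → EuclideanSpace ℝ (Fin m))
    (x v : EuclideanSpace ℝ (Fin n)) : Set (EuclideanSpace ℝ (Fin m)) :=
  {l | (fderiv ℝ Φ x).adjoint l = v ∧ l ∈ subdiff g (Φ x)}

/-- The second-order qualification condition at `(x, l)` for the composition `g ∘ Φ`. -/
def SOQC (g : EuclideanSpace ℝ (Fin m) → EReal)
    (Φ : EuclideanSpace ℝ (Fin n) → EuclideanSpace ℝ (Fin m))
    (x : EuclideanSpace ℝ (Fin n)) (l : EuclideanSpace ℝ (Fin m)) : Prop :=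
  coderiv (subdiff g) (Φ x) l 0 ∩ {y | (fderiv ℝ Φ x).adjoint y = 0} = {0}

/-- The Hessian `∇²⟨l, Φ⟩(x)` as a linear operator. -/
def hessian (Φ : EuclideanSpace ℝ (Fin n) → EuclideanSpace ℝ (Fin m))
    (l : EuclideanSpace ℝ (Fin m)) (x : EuclideanSpace ℝ (Fin n)) :
    EuclideanSpace ℝ (Fin n) →L[ℝ] EuclideanSpace ℝ (Fin n) :=
  fderiv ℝ (gradient fun y => inner ℝ l (Φ y)) x

/-- The mapping `G = f + ∂φ`. -/
def geMap (f : EuclideanSpace ℝ (Fin n) → EuclideanSpace ℝ (Fin n))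
    (φ : EuclideanSpace ℝ (Fin n) → EReal) (x : EuclideanSpace ℝ (Fin n)) :
    Set (EuclideanSpace ℝ (Fin n)) :=
  {u | ∃ v ∈ subdiff φ x, u = f x + v}

/-- The matrix of a linear operator in the standard basis. -/
def stdMatrix (T : EuclideanSpace ℝ (Fin n) →L[ℝ] EuclideanSpace ℝ (Fin m)) :
    Matrix (Fin m) (Fin n) ℝ :=
  Matrix.of fun i j => T (EuclideanSpace.single j 1) i

/-- The columns of `B` form a basis of the set `K` (in particular, `K` is a subspace). -/
def ColumnsFormBasis {s : ℕ} (B : Matrix (Fin n) (Fin s) ℝ)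
    (K : Set (EuclideanSpace ℝ (Fin n))) : Prop :=
  LinearIndependent ℝ (fun j : Fin s => (WithLp.toLp 2 (B.col j) : EuclideanSpace ℝ (Fin n))) ∧
    (Submodule.span ℝ (range fun j : Fin s =>
      (WithLp.toLp 2 (B.col j) : EuclideanSpace ℝ (Fin n))) : Set _) = K

/-- For every matrix `B` whose columns form a basis of `K`, the matrix `B* A B` is nonsingular
and `D = B (B* A B)⁻¹ B*`. -/
def ReducedInverseFormula (K : Set (EuclideanSpace ℝ (Fin n)))
    (A D : EuclideanSpace ℝ (Fin n) →L[ℝ] EuclideanSpace ℝ (Fin n)) : Prop :=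
  ∀ (s : ℕ) (B : Matrix (Fin n) (Fin s) ℝ), ColumnsFormBasis B K →
    IsUnit (B.transpose * stdMatrix A * B) ∧
    stdMatrix D = B * (B.transpose * stdMatrix A * B)⁻¹ * B.transpose

end Composite

end VarAn

end

namespace VarAn

section Submersions

variable {E F : Type*} [NormedAddCommGroup E] [InnerProductSpace ℝ E]
  [NormedAddCommGroup F] [InnerProductSpace ℝ F]

theorem mem_tangentCone_of_curve {Ω : Set E} {p w : E} {z : ℝ → E}
    (hz : Tendsto z (𝓝[>] 0) (𝓝 w)) (hΩ : ∀ᶠ t in 𝓝[>] (0 : ℝ), p + t • z t ∈ Ω) :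
    w ∈ tangentCone Ω p := by
  have ht : Tendsto (fun k : ℕ => 1 / ((k : ℝ) + 1)) atTop (𝓝[>] 0) :=
    tendsto_nhdsWithin_iff.2 ⟨tendsto_one_div_add_atTop_nhds_zero_nat,
      Eventually.of_forall fun k => by rw [mem_Ioi]; positivity⟩
  obtain ⟨k0, hk0⟩ := eventually_atTop.1 (ht.eventually hΩ)
  have ht' := ht.comp (tendsto_add_atTop_nat k0)
  exact ⟨_, _, fun k => by simp only [Function.comp]; positivity,
    ht'.mono_right nhdsWithin_le_nhds, hz.comp ht', fun k => hk0 _ (Nat.le_add_left _ _)⟩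

/-- Difference quotients along converging directions. -/
theorem tendsto_quotient_of_hasFDerivAt {ι : Type*} {l : Filter ι} {Ψ : E → F} {L : E →L[ℝ] F}
    {p w : E} (h : HasFDerivAt Ψ L p) {t : ι → ℝ} {z : ι → E} (ht : ∀ᶠ k in l, 0 < t k)
    (ht0 : Tendsto t l (𝓝 0)) (hz : Tendsto z l (𝓝 w)) :
    Tendsto (fun k => (t k)⁻¹ • (Ψ (p + t k • z k) - Ψ p)) l (𝓝 (L w)) := by
  refine (hasFDerivWithinAt_univ.2 h).lim ?_ (.of_forall fun _ => mem_univ _) ?_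
  · simpa using ht0.smul hz
  · refine hz.congr' ?_
    filter_upwards [ht] with k hk
    rw [smul_smul, inv_mul_cancel₀ hk.ne', one_smul]

/-- The normal cone of convex analysis. -/
def convexNormals (Q : Set F) (q : F) : Set F :=
  {v | ∀ y ∈ Q, inner ℝ v (y - q) ≤ 0}

/-- An injective operator in finite dimensions is bounded below, uniformly near it. -/
theorem eventually_norm_le_of_injective [FiniteDimensional ℝ F] {T : F →L[ℝ] E}
    (hT : Function.Injective T) :
    ∃ C : ℝ, 0 < C ∧ ∀ᶠ T' in 𝓝 T, ∀ η, ‖η‖ ≤ C * ‖T' η‖ := by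
  obtain ⟨c, hc, hca⟩ := (LinearMap.injective_iff_antilipschitz (T : F →ₗ[ℝ] E)).1 hT
  have hb : ∀ η, ‖η‖ ≤ c * ‖T η‖ := fun η => by
    simpa [dist_eq_norm] using hca.le_mul_dist η 0
  have hc' : (0 : ℝ) < c := hc
  refine ⟨2 * c, by positivity, ?_⟩
  have hnear : ∀ᶠ T' in 𝓝 T, ‖T' - T‖ < 1 / (2 * c) := by
    have := Metric.ball_mem_nhds T (show (0 : ℝ) < 1 / (2 * c) by positivity)
    filter_upwards [this] with T' hT'
    rwa [mem_ball, dist_eq_norm] at hT'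
  filter_upwards [hnear] with T' hT' η
  have h1 : ‖T η‖ ≤ ‖T' η‖ + ‖T' - T‖ * ‖η‖ := by
    have h2 : ‖(T' - T) η‖ ≤ ‖T' - T‖ * ‖η‖ := (T' - T).le_opNorm η
    have h3 : T η = T' η - (T' - T) η := by simp
    rw [h3]
    exact (norm_sub_le _ _).trans (by linarith)
  have h4 : ‖T' - T‖ * ‖η‖ ≤ 1 / (2 * c) * ‖η‖ := by gcongr
  have h5 : (c : ℝ) * (1 / (2 * c) * ‖η‖) = ‖η‖ / 2 := by field_simp
  have h6 := hb η
  have h7 : (c : ℝ) * ‖T η‖ ≤ c * (‖T' η‖ + 1 / (2 * c) * ‖η‖) := by gcongr; linarith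
  rw [mul_add, h5] at h7
  linarith

variable [FiniteDimensional ℝ E] [FiniteDimensional ℝ F]

/-- Every direction `w` is tangent to a curve on which a submersion moves affinely. -/
theorem exists_curve_of_surjective {Ψ : E → F} {L : E →L[ℝ] F} {p : E}
    (h : HasStrictFDerivAt Ψ L p) (hL : Function.Surjective L) (w : E) :
    ∃ z : ℝ → E, Tendsto z (𝓝[>] 0) (𝓝 w) ∧
      ∀ᶠ t in 𝓝[>] (0 : ℝ), Ψ (p + t • z t) = Ψ p + t • L w := by
  let N : Submodule ℝ E := LinearMap.ker (L : E →ₗ[ℝ] F)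
  let e : E ≃L[ℝ] F × N := L.equivProdOfSurjectiveOfIsCompl N.orthogonalProjectionOnto
    (LinearMap.range_eq_top.2 hL) (LinearMap.range_eq_top.2 fun y =>
      ⟨y, N.orthogonalProjectionOnto_mem_subspace_eq_self y⟩)
    (by simpa [N] using Submodule.isCompl_orthogonal (K := N))
  have he : HasStrictFDerivAt (fun x => (Ψ x, N.orthogonalProjectionOnto x))
      (e : E →L[ℝ] F × N) p :=
    h.prodMk N.orthogonalProjectionOnto.hasStrictFDerivAt
  set s := he.localInverse with hs
  have hs0 : s (Ψ p, N.orthogonalProjectionOnto p) = p := he.localInverse_apply_image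
  have hs' := he.to_localInverse
  let c : ℝ → F × N := fun t => (Ψ p, N.orthogonalProjectionOnto p) + t • e w
  have hc : HasDerivAt c (e w) 0 := by
    have := ((hasDerivAt_id (0 : ℝ)).smul_const (e w)).const_add
      ((Ψ p, N.orthogonalProjectionOnto p) : F × N)
    rwa [one_smul] at this
  have hc0 : c 0 = (Ψ p, N.orthogonalProjectionOnto p) := by simp [c]
  have hd : HasDerivAt (s ∘ c) w 0 := by
    have h1 : HasFDerivAt s (e.symm : F × N →L[ℝ] E) (c 0) := by
      rw [hc0]; exact hs'.hasFDerivAt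
    simpa using h1.comp_hasDerivAt 0 hc
  have hsc0 : (s ∘ c) 0 = p := by simp only [Function.comp, hc0, hs0]
  refine ⟨fun t => t⁻¹ • ((s ∘ c) t - p), ?_, ?_⟩
  · have := hd.tendsto_slope_zero_right
    rw [hsc0] at this
    simpa using this
  · have hcc : Tendsto c (𝓝[>] 0) (𝓝 (Ψ p, N.orthogonalProjectionOnto p)) := by
      rw [← hc0]; exact hc.continuousAt.tendsto.mono_left nhdsWithin_le_nhds
    filter_upwards [hcc.eventually he.eventually_right_inverse, self_mem_nhdsWithin] with t ht ht0
    have : (t : ℝ) ≠ 0 := ne_of_gt ht0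
    rw [smul_smul, mul_inv_cancel₀ this, one_smul, add_sub_cancel]
    have := congrArg Prod.fst ht
    simpa [c, e] using this

theorem injective_adjoint_of_surjective {L : E →L[ℝ] F} (hL : Function.Surjective L) :
    Function.Injective L.adjoint := by
  refine (injective_iff_map_eq_zero _).2 fun y hy => ?_
  obtain ⟨x, rfl⟩ := hL y
  rw [← inner_self_eq_zero (𝕜 := ℝ), ← ContinuousLinearMap.adjoint_inner_left, hy, inner_zero_left]

theorem surjective_of_injective_adjoint {L : E →L[ℝ] F} (hL : Function.Injective L.adjoint) :
    Function.Surjective L := by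
  have h1 : (LinearMap.range (L : E →ₗ[ℝ] F))ᗮ = ⊥ := by
    rw [L.orthogonal_range]
    exact LinearMap.ker_eq_bot.2 hL
  exact LinearMap.range_eq_top.1 (Submodule.orthogonal_eq_bot_iff.1 h1)

/-- Regular normals to the preimage of a convex set under a submersion. -/
theorem mem_regNormalCone_preimage_iff {Ψ : E → F} {L : E →L[ℝ] F} {p : E}
    (h : HasStrictFDerivAt Ψ L p) (hL : Function.Surjective L) {Q : Set F} (hQ : Convex ℝ Q)
    (hp : Ψ p ∈ Q) {Ω : Set E} (hΩ : ∀ᶠ x in 𝓝 p, x ∈ Ω ↔ Ψ x ∈ Q) (v : E) :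
    v ∈ regNormalCone Ω p ↔ ∃ η ∈ convexNormals Q (Ψ p), v = L.adjoint η := by
  constructor
  · intro hv
    have key : ∀ w, (∃ y ∈ Q, L w = y - Ψ p) → inner ℝ v w ≤ 0 := by
      rintro w ⟨y, hy, hw⟩
      obtain ⟨z, hz, hze⟩ := exists_curve_of_surjective h hL w
      have hpt : Tendsto (fun t : ℝ => p + t • z t) (𝓝[>] 0) (𝓝 p) := by
        have h0 : Tendsto (fun t : ℝ => t) (𝓝[>] 0) (𝓝 0) := tendsto_id.mono_left nhdsWithin_le_nhds
        simpa using (h0.smul hz).const_add p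
      refine hv w (mem_tangentCone_of_curve hz ?_)
      have h1 : ∀ᶠ t in 𝓝[>] (0 : ℝ), t < 1 := nhdsWithin_le_nhds (Iio_mem_nhds zero_lt_one)
      filter_upwards [hpt.eventually hΩ, hze, self_mem_nhdsWithin, h1] with t ht1 ht2 ht3 ht4
      rw [ht1, ht2, hw]
      exact hQ.add_smul_sub_mem hp hy ⟨le_of_lt ht3, ht4.le⟩
    have hker : v ∈ (LinearMap.ker (L : E →ₗ[ℝ] F))ᗮ := by
      rw [Submodule.mem_orthogonal']
      intro w hw
      have hw' : L w = 0 := hw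
      have h1 := key w ⟨Ψ p, hp, by simp [hw']⟩
      have h2 := key (-w) ⟨Ψ p, hp, by simp [hw']⟩
      rw [inner_neg_right] at h2
      linarith
    have hr : v ∈ LinearMap.range (L.adjoint : F →ₗ[ℝ] E) := by
      have h1 := ContinuousLinearMap.orthogonal_ker L
      rw [(Submodule.closed_of_finiteDimensional _).submodule_topologicalClosure_eq] at h1
      rwa [← h1]
    obtain ⟨η, rfl⟩ := hr
    refine ⟨η, fun y hy => ?_, rfl⟩
    obtain ⟨w, hw⟩ := hL (y - Ψ p)
    have := key w ⟨y, hy, hw⟩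
    rw [← hw]
    rwa [ContinuousLinearMap.coe_coe, ContinuousLinearMap.adjoint_inner_left] at this
  · rintro ⟨η, hη, rfl⟩ w ⟨t, z, ht, ht0, hz, hzΩ⟩
    rw [ContinuousLinearMap.adjoint_inner_left]
    have hlim := tendsto_quotient_of_hasFDerivAt h.hasFDerivAt (.of_forall ht) ht0 hz
    have hpt : Tendsto (fun k => p + t k • z k) atTop (𝓝 p) := by
      simpa using (ht0.smul hz).const_add p
    refine le_of_tendsto (tendsto_const_nhds.inner hlim) ?_
    filter_upwards [hpt.eventually hΩ] with k hk
    rw [inner_smul_right]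
    exact mul_nonpos_of_nonneg_of_nonpos (inv_nonneg.2 (ht k).le) (hη _ (hk.1 (hzΩ k)))

/-- Limiting normals to the preimage of a closed convex set under a submersion. -/
theorem mem_normalCone_preimage_iff {Ψ : E → F} {p : E} (h : ContDiffAt ℝ 1 Ψ p)
    (hL : Function.Surjective (fderiv ℝ Ψ p)) {Q : Set F} (hQ : Convex ℝ Q)
    {Ω : Set E} (hpΩ : p ∈ Ω) (hΩ : ∀ᶠ x in 𝓝 p, x ∈ Ω ↔ Ψ x ∈ Q) (v : E) :
    v ∈ normalCone Ω p ↔ ∃ η ∈ convexNormals Q (Ψ p), v = (fderiv ℝ Ψ p).adjoint η := by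
  have hpQ : Ψ p ∈ Q := hΩ.self_of_nhds.1 hpΩ
  constructor
  · rintro ⟨z, y, hzΩ, hy, hz, hyv⟩
    have hcont : ContinuousAt (fun x => (fderiv ℝ Ψ x).adjoint) p :=
      ContinuousLinearMap.adjoint.continuous.continuousAt.comp
        (h.continuousAt_fderiv one_ne_zero)
    obtain ⟨C, hC, hCb⟩ := eventually_norm_le_of_injective (injective_adjoint_of_surjective hL)
    have hstrict : ∀ᶠ x in 𝓝 p, HasStrictFDerivAt Ψ (fderiv ℝ Ψ x) x := by
      filter_upwards [h.eventually (by simp)] with x hx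
      exact hx.hasStrictFDerivAt one_ne_zero
    have hex : ∀ᶠ k in atTop, ∃ η ∈ convexNormals Q (Ψ (z k)),
        y k = (fderiv ℝ Ψ (z k)).adjoint η ∧ ‖η‖ ≤ C * ‖y k‖ := by
      filter_upwards [hz.eventually hΩ.eventually_nhds, hz.eventually hstrict,
        hz.eventually (hcont.eventually hCb)] with k hk1 hk2 hk3
      have hs : Function.Surjective (fderiv ℝ Ψ (z k)) := by
        refine surjective_of_injective_adjoint ((injective_iff_map_eq_zero _).2 fun η hη => ?_)
        have := hk3 η
        rw [hη, norm_zero, mul_zero] at this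
        exact norm_le_zero_iff.1 this
      obtain ⟨η, hη, hyη⟩ := (mem_regNormalCone_preimage_iff hk2 hs hQ
        (hk1.self_of_nhds.1 (hzΩ k)) hk1 (y k)).1 (hy k)
      exact ⟨η, hη, hyη, hyη ▸ hk3 η⟩
    obtain ⟨k0, hk0⟩ := eventually_atTop.1 hex
    choose! η hη using fun k (hk : k0 ≤ k) => hk0 k hk
    have hyb : Bornology.IsBounded (range y) := isBounded_range_of_tendsto y hyv
    obtain ⟨R, hR⟩ := hyb.exists_norm_le
    have hηb : ∀ k, η (k + k0) ∈ closedBall (0 : F) (C * R) := fun k => by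
      rw [mem_closedBall_zero_iff]
      refine (hη (k + k0) (Nat.le_add_left _ _)).2.2.trans ?_
      gcongr
      exact hR _ (mem_range_self _)
    obtain ⟨η0, -, θ, hθ, hη0⟩ := (isCompact_closedBall (0 : F) (C * R)).tendsto_subseq hηb
    have hsub : Tendsto (fun k => θ k + k0) atTop atTop :=
      (tendsto_add_atTop_nat k0).comp hθ.tendsto_atTop
    refine ⟨η0, fun q hq => ?_, ?_⟩
    · have hΨ : Tendsto (fun k => Ψ (z (θ k + k0))) atTop (𝓝 (Ψ p)) :=
        h.continuousAt.tendsto.comp (hz.comp hsub)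
      exact le_of_tendsto (hη0.inner (hΨ.const_sub q))
        (.of_forall fun k => (hη _ (Nat.le_add_left _ _)).1 q hq)
    · refine tendsto_nhds_unique (hyv.comp hsub) ?_
      have h1 : Tendsto (fun k => (fderiv ℝ Ψ (z (θ k + k0))).adjoint) atTop
        (𝓝 (fderiv ℝ Ψ p).adjoint) := hcont.tendsto.comp (hz.comp hsub)
      refine ((isBoundedBilinearMap_apply.continuous.tendsto ((fderiv ℝ Ψ p).adjoint, η0)).comp
        (h1.prodMk_nhds hη0)).congr fun k => ?_
      exact (hη _ (Nat.le_add_left _ _)).2.1.symm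
  · intro hv
    have hv' := (mem_regNormalCone_preimage_iff (h.hasStrictFDerivAt one_ne_zero) hL hQ hpQ hΩ v).2 hv
    exact ⟨fun _ => p, fun _ => v, fun _ => hpΩ, fun _ => hv', tendsto_const_nhds,
      tendsto_const_nhds⟩

end Submersions

section Polyhedral

variable {H : Type*} [NormedAddCommGroup H] [InnerProductSpace ℝ H]

theorem inner_withLp_real (p q : WithLp 2 (H × ℝ)) :
    inner ℝ p q = inner ℝ p.fst q.fst + p.snd * q.snd := by
  rw [WithLp.prod_inner_apply]
  simp [mul_comm]

theorem IsPolyhedral.convex {C : Set H} (hC : IsPolyhedral C) : Convex ℝ C := by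
  obtain ⟨k, a, b, rfl⟩ := hC
  rw [ofPred_forall]
  exact convex_iInter fun i => convex_halfSpace_le (innerₛₗ ℝ (a i)).isLinear _

theorem exists_real_of_ne {r : EReal} (h1 : r ≠ ⊤) (h2 : r ≠ ⊥) : ∃ α : ℝ, r = α :=
  ⟨r.toReal, (EReal.coe_toReal h1 h2).symm⟩

variable [FiniteDimensional ℝ H]

theorem mem_normalCone_convex_iff {C : Set H} (hC : Convex ℝ C) {x : H} (hx : x ∈ C) (v : H) :
    v ∈ normalCone C x ↔ v ∈ convexNormals C x := by
  rw [mem_normalCone_preimage_iff (Ψ := id) contDiffAt_id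
    (by rw [fderiv_id]; exact Function.surjective_id) hC hx (.of_forall fun _ => Iff.rfl)]
  rw [fderiv_id]
  have : (ContinuousLinearMap.id ℝ H).adjoint = ContinuousLinearMap.id ℝ H := by
    simpa using ContinuousLinearMap.adjoint_id (𝕜 := ℝ) (E := H)
  simp [this]

/-- Limiting subgradients of a polyhedral function are subgradients of convex analysis. -/
theorem IsPolyhedralFun.mem_subdiff_iff {g : H → EReal} (hg : IsPolyhedralFun g) {z : H} {α : ℝ}
    (hα : g z = α) (v : H) :
    v ∈ subdiff g z ↔ ∀ (z' : H) (α' : ℝ), g z' ≤ α' → inner ℝ v (z' - z) ≤ α' - α := by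
  have hmem : WithLp.toLp 2 (z, α) ∈ epi g := by simp [epi, hα]
  simp only [subdiff, mem_ofPred_eq, hα, EReal.toReal_coe, ne_eq, EReal.coe_ne_top,
    EReal.coe_ne_bot, not_false_eq_true, true_and]
  rw [mem_normalCone_convex_iff hg.polyhedral_epi.convex hmem]
  constructor
  · intro h z' α' hz'
    have := h (WithLp.toLp 2 (z', α')) hz'
    rw [inner_withLp_real] at this
    simp at this
    linarith
  · intro h q hq
    have := h q.fst q.snd hq
    rw [inner_withLp_real]
    simp
    linarith

/-- Near a point of subdifferentiability, the epigraph of a polyhedral function is a closed convex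
cone, which lives in the directions spanned by the subdifferential. -/
theorem IsPolyhedralFun.exists_reduction {g : H → EReal} (hg : IsPolyhedralFun g) {z0 l0 : H}
    {α0 : ℝ} (hα0 : g z0 = α0) (hl0 : l0 ∈ subdiff g z0) :
    ∃ Q : Set (WithLp 2 (vectorSpan ℝ (subdiff g z0) × ℝ)), Convex ℝ Q ∧
      (∀ q ∈ Q, ∀ t : ℝ, 0 ≤ t → t • q ∈ Q) ∧
      (∀ (z : H) (α : ℝ), g z ≤ α →
        WithLp.toLp 2 ((vectorSpan ℝ (subdiff g z0)).orthogonalProjectionOnto (z - z0),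
          α - α0 - inner ℝ l0 (z - z0)) ∈ Q) ∧
      (∀ᶠ z in 𝓝 z0, ∀ α : ℝ,
        WithLp.toLp 2 ((vectorSpan ℝ (subdiff g z0)).orthogonalProjectionOnto (z - z0),
          α - α0 - inner ℝ l0 (z - z0)) ∈ Q → g z ≤ α) ∧
      (∀ η : vectorSpan ℝ (subdiff g z0), l0 + η ∈ subdiff g z0 ↔
        ∀ q ∈ Q, inner ℝ η q.fst ≤ q.snd) := by
  obtain ⟨k, a, b, hab⟩ := hg.polyhedral_epi
  have hepi : ∀ (z : H) (α : ℝ), g z ≤ α ↔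
      ∀ i, inner ℝ (a i).fst z + (a i).snd * α ≤ b i := by
    intro z α
    have : WithLp.toLp 2 (z, α) ∈ epi g ↔ WithLp.toLp 2 (z, α) ∈
      {x | ∀ i, inner ℝ (a i) x ≤ b i} := by rw [hab]
    simpa [epi, inner_withLp_real, mul_comm] using this
  have h0 := (hepi z0 α0).1 hα0.le
  have hc : ∀ i, (a i).snd ≤ 0 := by
    intro i
    by_contra! hpos
    have h1 := (hepi z0 (α0 + (b i - inner ℝ (a i).fst z0 - (a i).snd * α0 + 1) / (a i).snd)).1
      (by
        rw [hα0, EReal.coe_le_coe_iff]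
        have := h0 i
        have : 0 ≤ (b i - inner ℝ (a i).fst z0 - (a i).snd * α0 + 1) / (a i).snd :=
          div_nonneg (by linarith) hpos.le
        linarith) i
    rw [mul_add, mul_div_cancel₀ _ hpos.ne'] at h1
    linarith
  set N := vectorSpan ℝ (subdiff g z0) with hN
  let I : Set (Fin k) := {i | inner ℝ (a i).fst z0 + (a i).snd * α0 = b i}
  let ν : Fin k → H := fun i => (a i).fst + (a i).snd • l0
  have hl0' := (hg.mem_subdiff_iff hα0 l0).1 hl0
  have hact : ∀ i ∈ I, ∀ (z : H) (α : ℝ), g z ≤ α →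
      inner ℝ (a i).fst (z - z0) + (a i).snd * (α - α0) ≤ 0 := by
    intro i hi z α hz
    have h1 := (hepi z α).1 hz i
    have h2 : inner ℝ (a i).fst z0 + (a i).snd * α0 = b i := hi
    rw [inner_sub_right, mul_sub]
    linarith
  have hνN : ∀ i ∈ I, ν i ∈ N := by
    intro i hi
    rcases (hc i).lt_or_eq with hlt | heq
    · have hne : (a i).snd ≠ 0 := hlt.ne
      have hmem : (-(a i).snd)⁻¹ • (a i).fst ∈ subdiff g z0 := by
        rw [hg.mem_subdiff_iff hα0]
        intro z α hz
        have h1 := hact i hi z α hz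
        rw [real_inner_smul_left, inv_mul_le_iff₀ (by linarith)]
        linarith
      have h2 := N.smul_mem (-(a i).snd) (vsub_mem_vectorSpan ℝ hmem hl0)
      rw [vsub_eq_sub, smul_sub, smul_smul, mul_inv_cancel₀ (neg_ne_zero.2 hne), one_smul, neg_smul,
        sub_neg_eq_add] at h2
      exact h2
    · have hmem : l0 + (a i).fst ∈ subdiff g z0 := by
        rw [hg.mem_subdiff_iff hα0]
        intro z α hz
        have h1 := hact i hi z α hz
        have h2 := hl0' z α hz
        rw [heq, zero_mul, add_zero] at h1
        rw [inner_add_left]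
        linarith
      have h2 := vsub_mem_vectorSpan ℝ hmem hl0
      simpa [ν, heq] using h2
  have hproj : ∀ i ∈ I, ∀ (z : H) (α : ℝ),
      inner ℝ (ν i) ((N.orthogonalProjectionOnto (z - z0) : N) : H) +
        (a i).snd * (α - α0 - inner ℝ l0 (z - z0)) =
      inner ℝ (a i).fst (z - z0) + (a i).snd * (α - α0) := by
    intro i hi z α
    have h1 := N.inner_orthogonalProjectionOnto_eq_of_mem_left ⟨ν i, hνN i hi⟩ (z - z0)
    rw [Submodule.coe_inner] at h1
    simp only at h1
    rw [h1]
    simp only [ν, inner_add_left, real_inner_smul_left]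
    ring
  let Q : Set (WithLp 2 (N × ℝ)) :=
    {q | ∀ i ∈ I, inner ℝ (ν i) (q.fst : H) + (a i).snd * q.snd ≤ 0}
  have hcone : ∀ q ∈ Q, ∀ t : ℝ, 0 ≤ t → t • q ∈ Q := by
    intro q hq t ht i hi
    have := mul_nonpos_of_nonneg_of_nonpos ht (hq i hi)
    simp only [WithLp.smul_fst, WithLp.smul_snd, Submodule.coe_smul, real_inner_smul_right,
      smul_eq_mul]
    linarith
  have hglob : ∀ (z : H) (α : ℝ), g z ≤ α → WithLp.toLp 2 (N.orthogonalProjectionOnto (z - z0),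
      α - α0 - inner ℝ l0 (z - z0)) ∈ Q := by
    intro z α hz i hi
    simp only [WithLp.toLp_fst, WithLp.toLp_snd]
    rw [hproj i hi]
    exact hact i hi z α hz
  have hQepi : ∀ q ∈ Q, ∀ᶠ t : ℝ in 𝓝[>] 0,
      g (z0 + t • (q.fst : H)) ≤ ((α0 + t * (q.snd + inner ℝ l0 (q.fst : H)) : ℝ) : EReal) := by
    intro q hq
    have hin : ∀ i, ∀ᶠ t : ℝ in 𝓝[>] 0, inner ℝ (a i).fst (z0 + t • (q.fst : H)) +
        (a i).snd * (α0 + t * (q.snd + inner ℝ l0 (q.fst : H))) ≤ b i := by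
      intro i
      by_cases hi : i ∈ I
      · filter_upwards [self_mem_nhdsWithin] with t ht
        have h1 := hq i hi
        have h2 : inner ℝ (a i).fst z0 + (a i).snd * α0 = b i := hi
        have h3 := mul_nonpos_of_nonneg_of_nonpos (le_of_lt (mem_Ioi.1 ht)) h1
        simp only [ν, inner_add_left, real_inner_smul_left] at h3
        rw [inner_add_right, real_inner_smul_right]
        linarith
      · have hlt : inner ℝ (a i).fst z0 + (a i).snd * α0 < b i := lt_of_le_of_ne (h0 i) hi
        have hcont : Continuous fun t : ℝ => inner ℝ (a i).fst (z0 + t • (q.fst : H)) +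
          (a i).snd * (α0 + t * (q.snd + inner ℝ l0 (q.fst : H))) := by fun_prop
        have := (hcont.tendsto 0).eventually_lt_const (u := b i) (by simpa using hlt)
        exact nhdsWithin_le_nhds (this.mono fun t ht => ht.le)
    filter_upwards [eventually_all.2 hin] with t ht
    exact (hepi _ _).2 ht
  have hsub : ∀ l ∈ subdiff g z0, ∀ q ∈ Q,
      inner ℝ (l - l0) (q.fst : H) ≤ q.snd := by
    intro l hl q hq
    obtain ⟨t, ht, ht0⟩ := ((hQepi q hq).and self_mem_nhdsWithin).exists
    have ht0' : 0 < t := ht0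
    have h1 := (hg.mem_subdiff_iff hα0 l).1 hl _ _ ht
    rw [add_sub_cancel_left, add_sub_cancel_left, real_inner_smul_right] at h1
    have h2 := le_of_mul_le_mul_left h1 ht0'
    rw [inner_sub_left]
    linarith
  refine ⟨Q, ?_, hcone, hglob, ?_, ?_⟩
  · intro q hq q' hq' s t hs ht hst i hi
    have h1 := mul_nonpos_of_nonneg_of_nonpos hs (hq i hi)
    have h2 := mul_nonpos_of_nonneg_of_nonpos ht (hq' i hi)
    simp only [WithLp.smul_fst, WithLp.smul_snd, WithLp.add_fst, WithLp.add_snd, Submodule.coe_add,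
      Submodule.coe_smul, inner_add_right, real_inner_smul_right, smul_eq_mul]
    linarith
  · have hin : ∀ i, ∀ᶠ z in 𝓝 z0, i ∉ I →
        inner ℝ (a i).fst z + (a i).snd * (α0 + inner ℝ l0 (z - z0)) < b i := by
      intro i
      by_cases hi : i ∈ I
      · exact .of_forall fun _ h => (h hi).elim
      · have hlt : inner ℝ (a i).fst z0 + (a i).snd * α0 < b i := lt_of_le_of_ne (h0 i) hi
        have hcont : Continuous fun z : H => inner ℝ (a i).fst z +
          (a i).snd * (α0 + inner ℝ l0 (z - z0)) := by fun_prop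
        exact ((hcont.tendsto z0).eventually_lt_const (u := b i) (by simpa using hlt)).mono
          fun _ h _ => h
    filter_upwards [eventually_all.2 hin] with z hz α hα
    rw [hepi]
    intro i
    by_cases hi : i ∈ I
    · have h1 := hα i hi
      simp only [WithLp.toLp_fst, WithLp.toLp_snd] at h1
      rw [hproj i hi, inner_sub_right] at h1
      have h2 : inner ℝ (a i).fst z0 + (a i).snd * α0 = b i := hi
      linarith
    · have h1 := hz i hi
      have h2 := hsub l0 hl0 _ hα
      simp only [sub_self, inner_zero_left, WithLp.toLp_snd] at h2
      have h3 := mul_le_mul_of_nonpos_left (show α0 + inner ℝ l0 (z - z0) ≤ α by linarith) (hc i)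
      linarith
  · intro η
    constructor
    · intro h q hq
      simpa using hsub _ h q hq
    · intro h
      rw [hg.mem_subdiff_iff hα0]
      intro z α hz
      have h1 := h _ (hglob z α hz)
      simp only [WithLp.toLp_fst, WithLp.toLp_snd] at h1
      have h2 := N.inner_orthogonalProjectionOnto_eq_of_mem_left η (z - z0)
      rw [h2] at h1
      rw [inner_add_left]
      linarith

end Polyhedral

section ChainRule

variable {E F : Type*} [NormedAddCommGroup E] [InnerProductSpace ℝ E]
  [NormedAddCommGroup F] [InnerProductSpace ℝ F] [FiniteDimensional ℝ F]

/-- The submersion which maps the epigraph of `g ∘ Φ` to the reduced cone of `g`. -/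
noncomputable def reducedMap (N : Submodule ℝ F) (Φ : E → F) (z0 l0 : F) (α0 : ℝ)
    (p : WithLp 2 (E × ℝ)) : WithLp 2 (N × ℝ) :=
  WithLp.toLp 2 (N.orthogonalProjectionOnto (Φ p.fst - z0),
    p.snd - α0 - inner ℝ l0 (Φ p.fst - z0))

/-- The derivative of `reducedMap`. -/
noncomputable def reducedDeriv (N : Submodule ℝ F) (Φ' : E →L[ℝ] F) (l0 : F) :
    WithLp 2 (E × ℝ) →L[ℝ] WithLp 2 (N × ℝ) :=
  ((WithLp.prodContinuousLinearEquiv 2 ℝ N ℝ).symm : (N × ℝ) →L[ℝ] WithLp 2 (N × ℝ)) ∘L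
    (((N.orthogonalProjectionOnto ∘L Φ') ∘L WithLp.fstL 2 ℝ E ℝ).prod
      (WithLp.sndL 2 ℝ E ℝ - (innerSL ℝ l0 ∘L Φ') ∘L WithLp.fstL 2 ℝ E ℝ))

theorem reducedDeriv_apply (N : Submodule ℝ F) (Φ' : E →L[ℝ] F) (l0 : F) (q : WithLp 2 (E × ℝ)) :
    reducedDeriv N Φ' l0 q = WithLp.toLp 2 (N.orthogonalProjectionOnto (Φ' q.fst),
      q.snd - inner ℝ l0 (Φ' q.fst)) := rfl

theorem hasFDerivAt_reducedMap (N : Submodule ℝ F) {Φ : E → F} {Φ' : E →L[ℝ] F} (z0 l0 : F)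
    (α0 : ℝ) {p : WithLp 2 (E × ℝ)} (h : HasFDerivAt Φ Φ' p.fst) :
    HasFDerivAt (reducedMap N Φ z0 l0 α0) (reducedDeriv N Φ' l0) p := by
  have h1 : HasFDerivAt (fun p : WithLp 2 (E × ℝ) => Φ p.fst - z0)
      (Φ' ∘L WithLp.fstL 2 ℝ E ℝ) p :=
    (HasFDerivAt.comp p (f := WithLp.fstL 2 ℝ E ℝ) h
      (WithLp.fstL 2 ℝ E ℝ).hasFDerivAt).sub_const z0
  have h2 := N.orthogonalProjectionOnto.hasFDerivAt.comp p h1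
  have h3 := (innerSL ℝ l0).hasFDerivAt.comp p h1
  have h4 := ((WithLp.sndL 2 ℝ E ℝ).hasFDerivAt (x := p)).sub_const α0
  exact ((WithLp.prodContinuousLinearEquiv 2 ℝ N ℝ).symm :
    (N × ℝ) →L[ℝ] WithLp 2 (N × ℝ)).hasFDerivAt.comp p (h2.prodMk (h4.sub h3))

theorem contDiffAt_reducedMap (N : Submodule ℝ F) {Φ : E → F} (z0 l0 : F)
    (α0 : ℝ) {p : WithLp 2 (E × ℝ)} (h : ContDiffAt ℝ 1 Φ p.fst) :
    ContDiffAt ℝ 1 (reducedMap N Φ z0 l0 α0) p := by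
  have h1 : ContDiffAt ℝ 1 (fun p : WithLp 2 (E × ℝ) => Φ p.fst - z0) p :=
    (ContDiffAt.comp p (f := WithLp.fstL 2 ℝ E ℝ) h
      (WithLp.fstL 2 ℝ E ℝ).contDiff.contDiffAt).sub contDiffAt_const
  have h2 := N.orthogonalProjectionOnto.contDiff.contDiffAt.comp p h1
  have h3 := (innerSL ℝ l0).contDiff.contDiffAt.comp p h1
  have h4 := ((WithLp.sndL 2 ℝ E ℝ).contDiff.contDiffAt (x := p) (n := 1)).sub
    (contDiffAt_const (c := α0))
  exact ((WithLp.prodContinuousLinearEquiv 2 ℝ N ℝ).symm :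
    (N × ℝ) →L[ℝ] WithLp 2 (N × ℝ)).contDiff.contDiffAt.comp p (h2.prodMk (h4.sub h3))

variable [FiniteDimensional ℝ E]

theorem surjective_projection_comp {N : Submodule ℝ F} {Φ' : E →L[ℝ] F}
    (h : ∀ η ∈ N, Φ'.adjoint η = 0 → η = 0) :
    Function.Surjective (N.orthogonalProjectionOnto ∘L Φ') := by
  refine surjective_of_injective_adjoint ((injective_iff_map_eq_zero _).2 fun η hη => ?_)
  rw [ContinuousLinearMap.adjoint_comp, Submodule.adjoint_orthogonalProjectionOnto] at hη
  exact Subtype.ext (h η η.2 hη)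

theorem surjective_reducedDeriv {N : Submodule ℝ F} {Φ' : E →L[ℝ] F} (l0 : F)
    (h : ∀ η ∈ N, Φ'.adjoint η = 0 → η = 0) : Function.Surjective (reducedDeriv N Φ' l0) := by
  intro q
  obtain ⟨w, hw⟩ := surjective_projection_comp h q.fst
  refine ⟨WithLp.toLp 2 (w, q.snd + inner ℝ l0 (Φ' w)), ?_⟩
  rw [reducedDeriv_apply]
  have hw' : N.orthogonalProjectionOnto (Φ' w) = q.fst := hw
  simp [hw']
  rfl

/-- Subgradients of a function whose epigraph is locally the preimage of a convex set under
`reducedMap`. -/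
theorem mem_subdiff_iff_of_reduction {φ : E → EReal} {N : Submodule ℝ F} {Φ : E → F} {z0 l0 : F}
    {α0 : ℝ} {Q : Set (WithLp 2 (N × ℝ))} (hQ : Convex ℝ Q) {x : E} (hΦ : ContDiffAt ℝ 1 Φ x)
    (hinj : ∀ η ∈ N, (fderiv ℝ Φ x).adjoint η = 0 → η = 0)
    (hloc : ∀ᶠ x' in 𝓝 x, ∀ α : ℝ, φ x' ≤ α ↔
      reducedMap N Φ z0 l0 α0 (WithLp.toLp 2 (x', α)) ∈ Q) (v : E) :
    v ∈ subdiff φ x ↔ ∃ α : ℝ, φ x = α ∧ ∃ η : N, v = (fderiv ℝ Φ x).adjoint (l0 + η) ∧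
      ∀ q ∈ Q, inner ℝ η (q.fst - N.orthogonalProjectionOnto (Φ x - z0)) ≤
        q.snd - (α - α0 - inner ℝ l0 (Φ x - z0)) := by
  have hnc : ∀ α : ℝ, φ x = α → (WithLp.toLp 2 (v, (-1 : ℝ)) ∈ normalCone (epi φ)
      (WithLp.toLp 2 (x, α)) ↔ ∃ η : N, v = (fderiv ℝ Φ x).adjoint (l0 + η) ∧
      ∀ q ∈ Q, inner ℝ η (q.fst - N.orthogonalProjectionOnto (Φ x - z0)) ≤
        q.snd - (α - α0 - inner ℝ l0 (Φ x - z0))) := by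
    intro α hα
    set p : WithLp 2 (E × ℝ) := WithLp.toLp 2 (x, α) with hp
    have hd : fderiv ℝ (reducedMap N Φ z0 l0 α0) p = reducedDeriv N (fderiv ℝ Φ x) l0 :=
      (hasFDerivAt_reducedMap N z0 l0 α0 (p := p)
        (hΦ.differentiableAt one_ne_zero).hasFDerivAt).fderiv
    have hΩ : ∀ᶠ p' in 𝓝 p, p' ∈ epi φ ↔ reducedMap N Φ z0 l0 α0 p' ∈ Q := by
      have ht : Tendsto (fun p' : WithLp 2 (E × ℝ) => p'.fst) (𝓝 p) (𝓝 x) :=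
        (WithLp.fstL 2 ℝ E ℝ).continuous.tendsto p
      filter_upwards [ht.eventually hloc] with p' hp'
      exact hp' p'.snd
    rw [mem_normalCone_preimage_iff (contDiffAt_reducedMap N z0 l0 α0 (p := p) hΦ)
      (hd ▸ surjective_reducedDeriv l0 hinj) hQ (show φ x ≤ α from hα.le) hΩ, hd]
    have hadj : ∀ ζ : WithLp 2 (N × ℝ), WithLp.toLp 2 (v, (-1 : ℝ)) =
        (reducedDeriv N (fderiv ℝ Φ x) l0).adjoint ζ ↔
        ζ.snd = -1 ∧ v = (fderiv ℝ Φ x).adjoint (l0 + ζ.fst) := by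
      intro ζ
      have hform : (reducedDeriv N (fderiv ℝ Φ x) l0).adjoint ζ =
          WithLp.toLp 2 ((fderiv ℝ Φ x).adjoint ((ζ.fst : F) - ζ.snd • l0), ζ.snd) := by
        refine ext_inner_right ℝ fun q => ?_
        rw [ContinuousLinearMap.adjoint_inner_left, reducedDeriv_apply, inner_withLp_real,
          inner_withLp_real]
        simp only [WithLp.toLp_fst, WithLp.toLp_snd]
        rw [ContinuousLinearMap.adjoint_inner_left,
          N.inner_orthogonalProjectionOnto_eq_of_mem_left, inner_sub_left, real_inner_smul_left]
        ring
      rw [hform]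
      constructor
      · intro h
        have h1 : (-1 : ℝ) = ζ.snd := congrArg WithLp.snd h
        have h2 : v = (fderiv ℝ Φ x).adjoint ((ζ.fst : F) - ζ.snd • l0) := congrArg WithLp.fst h
        refine ⟨h1.symm, ?_⟩
        rw [h2, ← h1, neg_one_smul, sub_neg_eq_add, add_comm]
      · rintro ⟨h1, h2⟩
        rw [h1, h2, neg_one_smul, sub_neg_eq_add, add_comm]
    constructor
    · rintro ⟨ζ, hζ, hv⟩
      obtain ⟨h1, h2⟩ := (hadj ζ).1 hv
      refine ⟨ζ.fst, h2, fun q hq => ?_⟩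
      have := hζ q hq
      rw [inner_withLp_real, h1] at this
      simp only [WithLp.sub_fst, WithLp.sub_snd, reducedMap, WithLp.toLp_fst, WithLp.toLp_snd, hp]
        at this
      linarith
    · rintro ⟨η, hv, hη⟩
      refine ⟨WithLp.toLp 2 (η, -1), fun q hq => ?_, (hadj _).2 ⟨rfl, hv⟩⟩
      have := hη q hq
      rw [inner_withLp_real]
      simp only [WithLp.sub_fst, WithLp.sub_snd, reducedMap, WithLp.toLp_fst, WithLp.toLp_snd, hp]
      linarith
  constructor
  · rintro ⟨h1, h2, h3⟩
    obtain ⟨α, hα⟩ := exists_real_of_ne h1 h2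
    refine ⟨α, hα, (hnc α hα).1 ?_⟩
    rwa [hα, EReal.toReal_coe] at h3
  · rintro ⟨α, hα, h⟩
    refine ⟨by simp [hα], by simp [hα], ?_⟩
    rw [hα, EReal.toReal_coe]
    exact (hnc α hα).2 h

end ChainRule

section LocalStructure

variable {E F : Type*} [NormedAddCommGroup E] [InnerProductSpace ℝ E] [FiniteDimensional ℝ E]
  [NormedAddCommGroup F] [InnerProductSpace ℝ F] [FiniteDimensional ℝ F]

theorem continuousAt_adjoint_fderiv {Φ : E → F} {x0 : E} (hΦ : ContDiffAt ℝ 1 Φ x0) :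
    ContinuousAt (fun x => (fderiv ℝ Φ x).adjoint) x0 :=
  ContinuousLinearMap.adjoint.continuous.continuousAt.comp (hΦ.continuousAt_fderiv one_ne_zero)

/-- Injectivity of the adjoint derivative on a subspace is stable, with a uniform bound. -/
theorem eventually_norm_le_adjoint_fderiv {Φ : E → F} {x0 : E} (hΦ : ContDiffAt ℝ 1 Φ x0)
    {N : Submodule ℝ F} (hinj : ∀ η ∈ N, (fderiv ℝ Φ x0).adjoint η = 0 → η = 0) :
    ∃ C : ℝ, 0 < C ∧ ∀ᶠ x in 𝓝 x0, ∀ η ∈ N, ‖η‖ ≤ C * ‖(fderiv ℝ Φ x).adjoint η‖ := by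
  have hT : Function.Injective ((fderiv ℝ Φ x0).adjoint ∘L N.subtypeL) :=
    (injective_iff_map_eq_zero _).2 fun η hη => Subtype.ext (hinj η η.2 hη)
  obtain ⟨C, hC, hCb⟩ := eventually_norm_le_of_injective hT
  have hcont : ContinuousAt (fun x => (fderiv ℝ Φ x).adjoint ∘L N.subtypeL) x0 :=
    (continuousAt_adjoint_fderiv hΦ).clm_comp continuousAt_const
  exact ⟨C, hC, (hcont.eventually hCb).mono fun x hx η hη => hx ⟨η, hη⟩⟩

theorem EReal_eq_of_forall_le_iff {r : EReal} {c : ℝ} (h : ∀ α : ℝ, r ≤ α ↔ c ≤ α) : r = c := by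
  refine le_antisymm ((h c).2 le_rfl) (le_of_not_gt fun hlt => ?_)
  obtain ⟨α, h1, h2⟩ := EReal.lt_iff_exists_real_btwn.1 hlt
  exact absurd ((h α).1 h1.le) (not_le.2 (EReal.coe_lt_coe_iff.1 h2))

/-- The epigraph and the subdifferential of `g ∘ Φ` near a point, in reduced form. -/
theorem exists_local_model {φ : E → EReal} {g : F → EReal} {Φ : E → F} {x0 : E} {l0 : F} {α0 : ℝ}
    (hg : IsPolyhedralFun g) (hΦ : ContDiffAt ℝ 1 Φ x0) (hφ : ∀ᶠ x in 𝓝 x0, φ x = g (Φ x))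
    (hα0 : g (Φ x0) = α0) (hl0 : l0 ∈ subdiff g (Φ x0)) {N : Submodule ℝ F}
    (hN : N = vectorSpan ℝ (subdiff g (Φ x0)))
    (hinj : ∀ η ∈ N, (fderiv ℝ Φ x0).adjoint η = 0 → η = 0) :
    ∃ Q : Set (WithLp 2 (N × ℝ)), (∀ q ∈ Q, ∀ t : ℝ, 0 ≤ t → t • q ∈ Q) ∧
      (∀ᶠ x in 𝓝 x0, ∀ α : ℝ, φ x ≤ α ↔
        reducedMap N Φ (Φ x0) l0 α0 (WithLp.toLp 2 (x, α)) ∈ Q) ∧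
      (∀ η : N, l0 + η ∈ subdiff g (Φ x0) ↔ ∀ q ∈ Q, inner ℝ η q.fst ≤ q.snd) ∧
      (∀ᶠ x in 𝓝 x0, ∀ v, v ∈ subdiff φ x ↔ ∃ α : ℝ, φ x = α ∧ ∃ η : N,
        v = (fderiv ℝ Φ x).adjoint (l0 + η) ∧
        ∀ q ∈ Q, inner ℝ η (q.fst - N.orthogonalProjectionOnto (Φ x - Φ x0)) ≤
          q.snd - (α - α0 - inner ℝ l0 (Φ x - Φ x0))) := by
  subst hN
  obtain ⟨Q, hQ, hcone, hglob, hloc, hsub⟩ := hg.exists_reduction hα0 hl0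
  have hepi : ∀ᶠ x in 𝓝 x0, ∀ α : ℝ, φ x ≤ α ↔
      reducedMap _ Φ (Φ x0) l0 α0 (WithLp.toLp 2 (x, α)) ∈ Q := by
    filter_upwards [hφ, hΦ.continuousAt.eventually hloc] with x hx1 hx2 α
    rw [hx1]
    exact ⟨hglob (Φ x) α, hx2 α⟩
  refine ⟨Q, hcone, hepi, hsub, ?_⟩
  obtain ⟨C, hC, hCb⟩ := eventually_norm_le_adjoint_fderiv hΦ hinj
  filter_upwards [hepi.eventually_nhds, hCb, hΦ.eventually (by simp)] with x hx1 hx2 hx3 v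
  refine mem_subdiff_iff_of_reduction hQ hx3 (fun η hη h0 => ?_) hx1 v
  have := hx2 η hη
  rw [h0, norm_zero, mul_zero] at this
  exact norm_le_zero_iff.1 this

/-- The subdifferential chain rule at the reference point. -/
theorem subdiff_comp_eq_image {φ : E → EReal} {g : F → EReal} {Φ : E → F} {x0 : E} {l0 : F}
    (hg : IsPolyhedralFun g) (hΦ : ContDiffAt ℝ 1 Φ x0) (hφ : ∀ᶠ x in 𝓝 x0, φ x = g (Φ x))
    (hl0 : l0 ∈ subdiff g (Φ x0))
    (hinj : ∀ η ∈ vectorSpan ℝ (subdiff g (Φ x0)), (fderiv ℝ Φ x0).adjoint η = 0 → η = 0) :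
    subdiff φ x0 = (fderiv ℝ Φ x0).adjoint '' subdiff g (Φ x0) := by
  obtain ⟨α0, hα0⟩ := exists_real_of_ne hl0.1 hl0.2.1
  obtain ⟨Q, -, -, hsub, hchain⟩ := exists_local_model hg hΦ hφ hα0 hl0 rfl hinj
  have hα : φ x0 = α0 := hφ.self_of_nhds.trans hα0
  ext v
  rw [hchain.self_of_nhds v]
  constructor
  · rintro ⟨α, hα', η, hv, hη⟩
    have : α = α0 := EReal.coe_injective (hα'.symm.trans hα)
    subst this
    refine ⟨l0 + η, (hsub η).2 fun q hq => ?_, hv.symm⟩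
    simpa using hη q hq
  · rintro ⟨l, hl, rfl⟩
    refine ⟨α0, hα, ⟨l - l0, vsub_mem_vectorSpan ℝ hl hl0⟩, by simp, fun q hq => ?_⟩
    simpa using (hsub ⟨l - l0, vsub_mem_vectorSpan ℝ hl hl0⟩).1 (by simpa using hl) q hq

/-- Near a relative interior point, subgradients of `g ∘ Φ` are attained only on the manifold
where `Φ` moves orthogonally to the subdifferential. -/
theorem eventually_of_mem_subdiff_comp {φ : E → EReal} {g : F → EReal} {Φ : E → F} {x0 : E}
    {l0 : F} (hg : IsPolyhedralFun g) (hΦ : ContDiffAt ℝ 1 Φ x0)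
    (hφ : ∀ᶠ x in 𝓝 x0, φ x = g (Φ x)) {N : Submodule ℝ F}
    (hN : N = vectorSpan ℝ (subdiff g (Φ x0)))
    (hinj : ∀ η ∈ N, (fderiv ℝ Φ x0).adjoint η = 0 → η = 0) {r : ℝ} (hr : 0 < r)
    (hri : ∀ η ∈ N, ‖η‖ < r → l0 + η ∈ subdiff g (Φ x0)) {ε : ℝ} (hε : 0 < ε) :
    ∀ᶠ p in 𝓝 (x0, (fderiv ℝ Φ x0).adjoint l0), p.2 ∈ subdiff φ p.1 →
      N.orthogonalProjectionOnto (Φ p.1 - Φ x0) = 0 ∧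
        ∃ η ∈ N, ‖η‖ < ε ∧ p.2 = (fderiv ℝ Φ p.1).adjoint (l0 + η) := by
  have hl0 : l0 ∈ subdiff g (Φ x0) := by simpa using hri 0 N.zero_mem (by simpa using hr)
  obtain ⟨α0, hα0⟩ := exists_real_of_ne hl0.1 hl0.2.1
  obtain ⟨Q, hcone, hepi, hsub, hchain⟩ := exists_local_model hg hΦ hφ hα0 hl0 hN hinj
  obtain ⟨C, hC, hCb⟩ := eventually_norm_le_adjoint_fderiv hΦ hinj
  have hfst : Tendsto Prod.fst (𝓝 (x0, (fderiv ℝ Φ x0).adjoint l0)) (𝓝 x0) := continuousAt_fst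
  have hsmall : ∀ᶠ p in 𝓝 (x0, (fderiv ℝ Φ x0).adjoint l0),
      C * ‖p.2 - (fderiv ℝ Φ p.1).adjoint l0‖ < min ε (r / 2) := by
    have h1 : Tendsto (fun p : E × E => (fderiv ℝ Φ p.1).adjoint l0)
        (𝓝 (x0, (fderiv ℝ Φ x0).adjoint l0)) (𝓝 ((fderiv ℝ Φ x0).adjoint l0)) :=
      ((continuousAt_adjoint_fderiv hΦ).clm_apply continuousAt_const).tendsto.comp hfst
    have h2 : Tendsto (fun p : E × E => C * ‖p.2 - (fderiv ℝ Φ p.1).adjoint l0‖)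
        (𝓝 (x0, (fderiv ℝ Φ x0).adjoint l0)) (𝓝 0) := by
      simpa using ((continuousAt_snd.tendsto.sub h1).norm).const_mul C
    exact h2.eventually_lt_const (by positivity)
  filter_upwards [hfst.eventually hepi, hfst.eventually hchain, hfst.eventually hCb, hsmall]
    with p hp1 hp2 hp3 hp4 hv
  obtain ⟨α, hα, η, hvη, hη⟩ := (hp2 p.2).1 hv
  have hηle : ‖(η : F)‖ < min ε (r / 2) := by
    refine (hp3 η η.2).trans_lt ?_
    have h1 : (fderiv ℝ Φ p.1).adjoint η = p.2 - (fderiv ℝ Φ p.1).adjoint l0 := by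
      rw [hvη, map_add, add_sub_cancel_left]
    rw [h1]
    exact hp4
  refine ⟨?_, η, η.2, hηle.trans_le (min_le_left _ _), hvη⟩
  have hmem := (hp1 α).1 hα.le
  set q := reducedMap N Φ (Φ x0) l0 α0 (WithLp.toLp 2 (p.1, α)) with hq
  set ν := N.orthogonalProjectionOnto (Φ p.1 - Φ x0) with hν
  have hq1 : q.fst = ν := rfl
  have h0 := hη (((0 : ℝ)) • q) (hcone q hmem 0 le_rfl)
  have hq2 : α - α0 - inner ℝ l0 (Φ p.1 - Φ x0) = q.snd := rfl
  rw [hq2] at h0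
  simp only [zero_smul, WithLp.zero_fst, WithLp.zero_snd, zero_sub, inner_neg_right] at h0
  have hs : 0 < r / 2 / (‖ν‖ + 1) := by positivity
  have h1 : l0 + ((η + (r / 2 / (‖ν‖ + 1)) • ν : N) : F) ∈ subdiff g (Φ x0) := by
    refine hri _ (Subtype.coe_prop _) ?_
    have h2 : ‖(r / 2 / (‖ν‖ + 1)) • ν‖ ≤ r / 2 := by
      rw [norm_smul, Real.norm_of_nonneg hs.le, div_mul_eq_mul_div, div_le_iff₀ (by positivity)]
      nlinarith [norm_nonneg ν]
    have h3 : ‖η‖ < r / 2 := hηle.trans_le (min_le_right _ _)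
    calc ‖((η + (r / 2 / (‖ν‖ + 1)) • ν : N) : F)‖ ≤ ‖η‖ + ‖(r / 2 / (‖ν‖ + 1)) • ν‖ :=
          norm_add_le _ _
      _ < r := by linarith
  have h2 := (hsub _).1 h1 q hmem
  rw [hq1, inner_add_left, real_inner_smul_left, real_inner_self_eq_norm_sq] at h2
  have h3 : r / 2 / (‖ν‖ + 1) * ‖ν‖ ^ 2 ≤ 0 := by linarith
  have h4 : ‖ν‖ ^ 2 ≤ 0 := by
    by_contra! h
    exact absurd h3 (not_le.2 (mul_pos hs h))
  exact norm_eq_zero.1 (pow_eq_zero_iff two_ne_zero |>.1 (le_antisymm h4 (sq_nonneg _)))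

/-- On the manifold where `Φ` moves orthogonally to the subdifferential, `g ∘ Φ` is smooth up to
normal directions. -/
theorem eventually_mem_subdiff_comp {φ : E → EReal} {g : F → EReal} {Φ : E → F} {x0 : E}
    {l0 : F} {α0 : ℝ} (hg : IsPolyhedralFun g) (hΦ : ContDiffAt ℝ 1 Φ x0)
    (hφ : ∀ᶠ x in 𝓝 x0, φ x = g (Φ x)) (hα0 : g (Φ x0) = α0) {N : Submodule ℝ F}
    (hN : N = vectorSpan ℝ (subdiff g (Φ x0)))
    (hinj : ∀ η ∈ N, (fderiv ℝ Φ x0).adjoint η = 0 → η = 0) {r : ℝ} (hr : 0 < r)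
    (hri : ∀ η ∈ N, ‖η‖ < r → l0 + η ∈ subdiff g (Φ x0)) :
    ∀ᶠ x in 𝓝 x0, N.orthogonalProjectionOnto (Φ x - Φ x0) = 0 →
      φ x = ((α0 + inner ℝ l0 (Φ x - Φ x0) : ℝ) : EReal) ∧
      ∀ η ∈ N, ‖η‖ < r → (fderiv ℝ Φ x).adjoint (l0 + η) ∈ subdiff φ x := by
  have hl0 : l0 ∈ subdiff g (Φ x0) := by simpa using hri 0 N.zero_mem (by simpa using hr)
  obtain ⟨Q, hcone, hepi, hsub, hchain⟩ := exists_local_model hg hΦ hφ hα0 hl0 hN hinj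
  have hφ0 : φ x0 = α0 := hφ.self_of_nhds.trans hα0
  have hup : ∀ γ : ℝ, (WithLp.toLp 2 ((0 : N), γ)) ∈ Q ↔ 0 ≤ γ := by
    intro γ
    constructor
    · intro h
      have := (hsub 0).1 (by simpa using hl0) _ h
      simpa using this
    · intro h
      have := (hepi.self_of_nhds (α0 + γ)).1 (by rw [hφ0, EReal.coe_le_coe_iff]; linarith)
      simpa [reducedMap] using this
  filter_upwards [hepi, hchain] with x hx1 hx2 hP
  have hval : φ x = ((α0 + inner ℝ l0 (Φ x - Φ x0) : ℝ) : EReal) := by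
    refine EReal_eq_of_forall_le_iff fun α => ?_
    rw [hx1]
    simp only [reducedMap, WithLp.toLp_fst, WithLp.toLp_snd]
    rw [hP, hup]
    constructor <;> intro h <;> linarith
  refine ⟨hval, fun η hη hηr => (hx2 _).2 ⟨_, hval, ⟨η, hη⟩, rfl, fun q hq => ?_⟩⟩
  have := (hsub ⟨η, hη⟩).1 (hri η hη hηr) q hq
  rw [hP]
  simpa using this

end LocalStructure

section RelativeInterior

variable {E F : Type*} [NormedAddCommGroup E] [InnerProductSpace ℝ E]
  [NormedAddCommGroup F] [InnerProductSpace ℝ F]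

theorem exists_ball_of_mem_intrinsicInterior {s : Set F} {x : F}
    (hx : x ∈ intrinsicInterior ℝ s) :
    ∃ r : ℝ, 0 < r ∧ ∀ η ∈ vectorSpan ℝ s, ‖η‖ < r → x + η ∈ s := by
  obtain ⟨y, hy, rfl⟩ := mem_intrinsicInterior.1 hx
  obtain ⟨r, hr, hball⟩ := Metric.mem_nhds_iff.1 (mem_interior_iff_mem_nhds.1 hy)
  refine ⟨r, hr, fun η hη hηr => ?_⟩
  have hmem : (y : F) + η ∈ affineSpan ℝ s := by
    rw [add_comm]
    exact AffineSubspace.vadd_mem_of_mem_direction (by rwa [direction_affineSpan]) y.2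
  have := @hball ⟨_, hmem⟩ (by
    rw [mem_ball, Subtype.dist_eq, dist_eq_norm]
    simpa using hηr)
  exact this

variable [FiniteDimensional ℝ F]

theorem IsPolyhedralFun.convex_subdiff {g : F → EReal} (hg : IsPolyhedralFun g) (z : F) :
    Convex ℝ (subdiff g z) := by
  intro l hl l' hl' s t hs ht hst
  obtain ⟨α, hα⟩ := exists_real_of_ne hl.1 hl.2.1
  rw [hg.mem_subdiff_iff hα] at hl hl' ⊢
  intro z' α' hz'
  have h1 := mul_le_mul_of_nonneg_left (hl z' α' hz') hs
  have h2 := mul_le_mul_of_nonneg_left (hl' z' α' hz') ht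
  rw [inner_add_left, real_inner_smul_left, real_inner_smul_left]
  have : α' - α = s * (α' - α) + t * (α' - α) := by rw [← add_mul, hst, one_mul]
  linarith

/-- The directions of the subdifferential are coderivative values at the origin. -/
theorem vectorSpan_subset_coderiv_subdiff {g : F → EReal} (hg : IsPolyhedralFun g) {z l : F}
    (hl : l ∈ subdiff g z) {y : F} (hy : y ∈ vectorSpan ℝ (subdiff g z)) :
    y ∈ coderiv (subdiff g) z l 0 := by
  have hconv := hg.convex_subdiff z
  obtain ⟨l', hl'⟩ := Set.Nonempty.intrinsicInterior hconv ⟨l, hl⟩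
  obtain ⟨r, hr, hri⟩ := exists_ball_of_mem_intrinsicInterior hl'
  have hadj : (fderiv ℝ (id : F → F) z).adjoint = ContinuousLinearMap.id ℝ F := by
    rw [fderiv_id]; exact ContinuousLinearMap.adjoint_id
  set s : ℕ → ℝ := fun k => 1 / ((k : ℝ) + 1) with hs
  have hs0 : ∀ k, 0 < s k := fun k => by positivity
  have hs1 : ∀ k, s k ≤ 1 := fun k => by
    rw [hs]; simp only; rw [div_le_one (by positivity)]; simp
  have hst : Tendsto s atTop (𝓝 0) := tendsto_one_div_add_atTop_nhds_zero_nat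
  have hball : ∀ k, ∀ η ∈ vectorSpan ℝ (subdiff g z), ‖η‖ < s k * r →
      l + s k • (l' - l) + η ∈ subdiff g z := by
    intro k η hη hηr
    have h1 : l' + (s k)⁻¹ • η ∈ subdiff g z := by
      refine hri _ (Submodule.smul_mem _ _ hη) ?_
      rw [norm_smul, norm_inv, Real.norm_of_nonneg (hs0 k).le, inv_mul_lt_iff₀ (hs0 k)]
      exact hηr
    have h2 := hconv.add_smul_sub_mem hl h1 ⟨(hs0 k).le, hs1 k⟩
    convert h2 using 1
    rw [add_sub_right_comm, smul_add, smul_smul, mul_inv_cancel₀ (hs0 k).ne', one_smul, add_assoc]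
  refine ⟨fun k => WithLp.toLp 2 (z, l + s k • (l' - l)), fun _ => WithLp.toLp 2 (y, -0),
    fun k => ?_, fun k => ?_, ?_, tendsto_const_nhds⟩
  · have := hball k 0 (Submodule.zero_mem _) (by simpa using mul_pos (hs0 k) hr)
    simpa [gph] using this
  · rintro w ⟨t, ζ, ht, ht0, hζ, hmem⟩
    have hev := eventually_of_mem_subdiff_comp (φ := g) (Φ := id) (x0 := z) hg contDiffAt_id
      (.of_forall fun _ => rfl) rfl (by rw [hadj]; intro η _ h; exact h)
      (mul_pos (hs0 k) hr) (hball k) one_pos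
    rw [hadj] at hev
    have hζ1 : Tendsto (fun j => (ζ j).fst) atTop (𝓝 w.fst) :=
      ((WithLp.fstL 2 ℝ F F).continuous.tendsto w).comp hζ
    have hζ2 : Tendsto (fun j => (ζ j).snd) atTop (𝓝 w.snd) :=
      ((WithLp.sndL 2 ℝ F F).continuous.tendsto w).comp hζ
    have hp : Tendsto (fun j => (z + t j • (ζ j).fst, l + s k • (l' - l) + t j • (ζ j).snd)) atTop
        (𝓝 (z, ContinuousLinearMap.id ℝ F (l + s k • (l' - l)))) := by
      refine Tendsto.prodMk_nhds ?_ ?_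
      · simpa using (ht0.smul hζ1).const_add z
      · simpa using (ht0.smul hζ2).const_add (l + s k • (l' - l))
    have hzero : ∀ᶠ j in atTop, inner ℝ y (ζ j).fst = 0 := by
      filter_upwards [hp.eventually hev] with j hj
      obtain ⟨h1, -⟩ := hj (hmem j)
      simp only [id, add_sub_cancel_left] at h1
      have h2 := (vectorSpan ℝ (subdiff g z)).inner_orthogonalProjectionOnto_eq_of_mem_left
        ⟨y, hy⟩ (t j • (ζ j).fst)
      rw [h1, inner_zero_right] at h2
      rw [real_inner_smul_right] at h2
      exact (mul_eq_zero.1 h2.symm).resolve_left (ht j).ne'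
    rw [WithLp.prod_inner_apply]
    simp only [neg_zero, inner_zero_left, add_zero]
    exact le_of_tendsto (tendsto_const_nhds.inner hζ1) (hzero.mono fun j hj => hj.le)
  · refine ((WithLp.prod_continuous_toLp 2 F F).tendsto (z, l)).comp ?_
    refine tendsto_const_nhds.prodMk_nhds ?_
    simpa using (hst.smul_const (l' - l)).const_add l

variable [FiniteDimensional ℝ E]

/-- Relative interior points of the subdifferential of a composition come from relative interior
points of the outer subdifferential. -/
theorem exists_ball_multiplier {φ : E → EReal} {g : F → EReal} {Φ : E → F} {x0 : E} {l0 : F}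
    (hg : IsPolyhedralFun g) (hΦ : ContDiffAt ℝ 1 Φ x0) (hφ : ∀ᶠ x in 𝓝 x0, φ x = g (Φ x))
    (hl0 : l0 ∈ subdiff g (Φ x0))
    (hinj : ∀ η ∈ vectorSpan ℝ (subdiff g (Φ x0)), (fderiv ℝ Φ x0).adjoint η = 0 → η = 0)
    (hri : (fderiv ℝ Φ x0).adjoint l0 ∈ intrinsicInterior ℝ (subdiff φ x0)) :
    ∃ r : ℝ, 0 < r ∧ ∀ η ∈ vectorSpan ℝ (subdiff g (Φ x0)), ‖η‖ < r →
      l0 + η ∈ subdiff g (Φ x0) := by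
  obtain ⟨r, hr, hball⟩ := exists_ball_of_mem_intrinsicInterior hri
  have himg := subdiff_comp_eq_image hg hΦ hφ hl0 hinj
  set T := (fderiv ℝ Φ x0).adjoint with hT
  have hspan : ∀ η ∈ vectorSpan ℝ (subdiff g (Φ x0)), T η ∈ vectorSpan ℝ (subdiff φ x0) := by
    intro η hη
    rw [himg]
    have h1 := AffineMap.map_vectorSpan (T : F →ₗ[ℝ] E).toAffineMap
      (s := subdiff g (Φ x0))
    have h2 : T η ∈ (vectorSpan ℝ (subdiff g (Φ x0))).map (T : F →ₗ[ℝ] E) :=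
      Submodule.mem_map_of_mem hη
    simpa using (h1 ▸ h2 :)
  refine ⟨r / (‖T‖ + 1), by positivity, fun η hη hηr => ?_⟩
  have h1 : ‖T η‖ < r := by
    rw [lt_div_iff₀ (by positivity)] at hηr
    have := T.le_opNorm η
    nlinarith [norm_nonneg η]
  have h2 := hball _ (hspan η hη) h1
  rw [himg] at h2
  obtain ⟨l, hl, hle⟩ := h2
  have h3 : T (l - l0 - η) = 0 := by
    rw [map_sub, map_sub, hle]; abel
  have h4 := hinj _ (Submodule.sub_mem _ (vsub_mem_vectorSpan ℝ hl hl0) hη) h3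
  rw [vsub_eq_sub, sub_sub, sub_eq_zero] at h4
  rwa [← h4]

end RelativeInterior

section CriticalCone

variable {E F : Type*} [NormedAddCommGroup E] [InnerProductSpace ℝ E]
  [NormedAddCommGroup F] [InnerProductSpace ℝ F] [FiniteDimensional ℝ F]

/-- Subgradients of the outer function bound the subderivative from below. -/
theorem inner_le_subderiv {φ : E → EReal} {g : F → EReal} {Φ : E → F} {x0 : E} {l : F}
    (hg : IsPolyhedralFun g) (hΦ : ContDiffAt ℝ 1 Φ x0) (hφ : ∀ᶠ x in 𝓝 x0, φ x = g (Φ x))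
    (hl : l ∈ subdiff g (Φ x0)) (w : E) :
    ((inner ℝ l (fderiv ℝ Φ x0 w) : ℝ) : EReal) ≤ subderiv φ x0 w := by
  obtain ⟨α0, hα0⟩ := exists_real_of_ne hl.1 hl.2.1
  have hφ0 : φ x0 = α0 := hφ.self_of_nhds.trans hα0
  have hpos : ∀ᶠ p : ℝ × E in 𝓝[>] 0 ×ˢ 𝓝 w, 0 < p.1 :=
    tendsto_fst.eventually (self_mem_nhdsWithin : Ioi (0 : ℝ) ∈ 𝓝[>] 0)
  have ht0 : Tendsto (fun p : ℝ × E => p.1) (𝓝[>] 0 ×ˢ 𝓝 w) (𝓝 0) :=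
    tendsto_fst.mono_right nhdsWithin_le_nhds
  have hz : Tendsto (fun p : ℝ × E => p.2) (𝓝[>] 0 ×ˢ 𝓝 w) (𝓝 w) := tendsto_snd
  have hlim := tendsto_quotient_of_hasFDerivAt (hΦ.differentiableAt one_ne_zero).hasFDerivAt
    hpos ht0 hz
  have hlim2 : Tendsto (fun p : ℝ × E =>
      ((inner ℝ l (p.1⁻¹ • (Φ (x0 + p.1 • p.2) - Φ x0)) : ℝ) : EReal)) (𝓝[>] 0 ×ˢ 𝓝 w)
      (𝓝 ((inner ℝ l (fderiv ℝ Φ x0 w) : ℝ) : EReal)) :=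
    (continuous_coe_real_ereal.tendsto _).comp (tendsto_const_nhds.inner hlim)
  rw [← hlim2.liminf_eq]
  refine liminf_le_liminf ?_
  have hx : Tendsto (fun p : ℝ × E => x0 + p.1 • p.2) (𝓝[>] 0 ×ˢ 𝓝 w) (𝓝 x0) := by
    simpa using (ht0.smul hz).const_add x0
  filter_upwards [hpos, hx.eventually hφ] with p hp hp2
  rw [hp2, hφ0, EReal.le_div_iff_mul_le (by exact_mod_cast hp) (EReal.coe_ne_top _),
    ← EReal.coe_mul, EReal.le_sub_iff_add_le (by simp) (by simp), ← EReal.coe_add]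
  refine EReal.le_of_forall_lt_iff_le.1 fun α hα => ?_
  have h1 := (hg.mem_subdiff_iff hα0 l).1 hl _ α hα.le
  rw [EReal.coe_le_coe_iff, real_inner_smul_right]
  have : p.1⁻¹ * inner ℝ l (Φ (x0 + p.1 • p.2) - Φ x0) * p.1 =
    inner ℝ l (Φ (x0 + p.1 • p.2) - Φ x0) := by field_simp
  linarith

variable [FiniteDimensional ℝ E]

/-- Under nondegeneracy, the critical cone is the tangent space of the active manifold. -/
theorem mem_criticalCone_iff {φ : E → EReal} {g : F → EReal} {Φ : E → F} {x0 : E}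
    {l0 : F} (hg : IsPolyhedralFun g) (hΦ : ContDiffAt ℝ 1 Φ x0)
    (hφ : ∀ᶠ x in 𝓝 x0, φ x = g (Φ x)) {N : Submodule ℝ F}
    (hN : N = vectorSpan ℝ (subdiff g (Φ x0)))
    (hinj : ∀ η ∈ N, (fderiv ℝ Φ x0).adjoint η = 0 → η = 0) {r : ℝ} (hr : 0 < r)
    (hri : ∀ η ∈ N, ‖η‖ < r → l0 + η ∈ subdiff g (Φ x0)) (w : E) :
    w ∈ criticalCone φ x0 ((fderiv ℝ Φ x0).adjoint l0) ↔
      N.orthogonalProjectionOnto (fderiv ℝ Φ x0 w) = 0 := by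
  have hl0 : l0 ∈ subdiff g (Φ x0) := by simpa using hri 0 N.zero_mem (by simpa using hr)
  obtain ⟨α0, hα0⟩ := exists_real_of_ne hl0.1 hl0.2.1
  have hφ0 : φ x0 = α0 := hφ.self_of_nhds.trans hα0
  have hmem : w ∈ criticalCone φ x0 ((fderiv ℝ Φ x0).adjoint l0) ↔
      ((inner ℝ l0 (fderiv ℝ Φ x0 w) : ℝ) : EReal) = subderiv φ x0 w := by
    rw [← ContinuousLinearMap.adjoint_inner_left]; rfl
  rw [hmem]
  constructor
  · intro h
    set ν := N.orthogonalProjectionOnto (fderiv ℝ Φ x0 w) with hν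
    have hs : 0 < r / 2 / (‖ν‖ + 1) := by positivity
    have h1 : l0 + (r / 2 / (‖ν‖ + 1)) • (ν : F) ∈ subdiff g (Φ x0) := by
      refine hri _ (N.smul_mem _ ν.2) ?_
      rw [norm_smul, Real.norm_of_nonneg hs.le, div_mul_eq_mul_div, div_lt_iff₀ (by positivity),
        Submodule.coe_norm]
      nlinarith [norm_nonneg (ν : F)]
    have h2 := inner_le_subderiv hg hΦ hφ h1 w
    rw [← h, EReal.coe_le_coe_iff, inner_add_left, real_inner_smul_left,
      ← N.inner_orthogonalProjectionOnto_eq_of_mem_left, ← hν, real_inner_self_eq_norm_sq] at h2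
    have h4 : ‖ν‖ ^ 2 ≤ 0 := by
      by_contra! h
      have := mul_pos hs h
      linarith
    exact norm_eq_zero.1 (pow_eq_zero_iff two_ne_zero |>.1 (le_antisymm h4 (sq_nonneg _)))
  · intro hw
    refine le_antisymm (inner_le_subderiv hg hΦ hφ hl0 w) ?_
    have hstrict : HasStrictFDerivAt (fun x => N.orthogonalProjectionOnto (Φ x))
        (N.orthogonalProjectionOnto ∘L fderiv ℝ Φ x0) x0 :=
      N.orthogonalProjectionOnto.hasStrictFDerivAt.comp x0 (hΦ.hasStrictFDerivAt one_ne_zero)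
    obtain ⟨z, hz, hze⟩ := exists_curve_of_surjective hstrict (surjective_projection_comp hinj) w
    have h0 : Tendsto (fun t : ℝ => t) (𝓝[>] 0) (𝓝 0) := tendsto_id.mono_left nhdsWithin_le_nhds
    have hx : Tendsto (fun t : ℝ => x0 + t • z t) (𝓝[>] 0) (𝓝 x0) := by
      simpa using (h0.smul hz).const_add x0
    have hlim := tendsto_quotient_of_hasFDerivAt (hΦ.differentiableAt one_ne_zero).hasFDerivAt
      (self_mem_nhdsWithin : Ioi (0 : ℝ) ∈ 𝓝[>] 0) h0 hz
    have hlim2 : Tendsto (fun t : ℝ =>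
        ((inner ℝ l0 (t⁻¹ • (Φ (x0 + t • z t) - Φ x0)) : ℝ) : EReal)) (𝓝[>] 0)
        (𝓝 ((inner ℝ l0 (fderiv ℝ Φ x0 w) : ℝ) : EReal)) :=
      (continuous_coe_real_ereal.tendsto _).comp (tendsto_const_nhds.inner hlim)
    have hcurve : Tendsto (fun t : ℝ => (t, z t)) (𝓝[>] 0) (𝓝[>] 0 ×ˢ 𝓝 w) :=
      tendsto_id.prodMk hz
    have heq : (fun t : ℝ => (φ (x0 + t • z t) - φ x0) / (t : EReal)) =ᶠ[𝓝[>] 0] fun t : ℝ =>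
        ((inner ℝ l0 (t⁻¹ • (Φ (x0 + t • z t) - Φ x0)) : ℝ) : EReal) := by
      filter_upwards [hx.eventually (eventually_mem_subdiff_comp hg hΦ hφ hα0 hN hinj hr hri), hze]
        with t ht1 ht2
      have hP : N.orthogonalProjectionOnto (Φ (x0 + t • z t) - Φ x0) = 0 := by
        rw [map_sub, ht2]
        simp [hw]
      rw [(ht1 hP).1, hφ0, ← EReal.coe_sub, ← EReal.coe_div, add_sub_cancel_left,
        real_inner_smul_right, div_eq_inv_mul]
    rw [← hlim2.liminf_eq, ← liminf_congr heq]
    exact liminf_le_liminf_of_le hcurve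

end CriticalCone

section Regularity

variable {X Y : Type*} [NormedAddCommGroup X] [NormedAddCommGroup Y]

theorem IsLipschitzLocalization.apply_eq {S : Y → Set X} {u : Y} {x : X} {σ : Y → X}
    (h : IsLipschitzLocalization S u x σ) : σ u = x := by
  obtain ⟨hx, U, hU, V, hV, hS, -⟩ := h
  have : x ∈ S u ∩ U := ⟨hx, mem_of_mem_nhds hU⟩
  rw [hS u (mem_of_mem_nhds hV)] at this
  exact this.symm

theorem IsLipschitzLocalization.continuousAt {S : Y → Set X} {u : Y} {x : X} {σ : Y → X}
    (h : IsLipschitzLocalization S u x σ) : ContinuousAt σ u := by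
  obtain ⟨hx, U, hU, V, hV, hS, L, hL⟩ := h
  exact hL.continuousOn.continuousAt hV

/-- The germ of a Lipschitz localization is unique. -/
theorem IsLipschitzLocalization.eventuallyEq {S : Y → Set X} {u : Y} {x : X} {σ τ : Y → X}
    (hσ : IsLipschitzLocalization S u x σ) (hτ : IsLipschitzLocalization S u x τ) :
    σ =ᶠ[𝓝 u] τ := by
  have hc : Tendsto σ (𝓝 u) (𝓝 x) := hσ.apply_eq ▸ hσ.continuousAt.tendsto
  obtain ⟨-, U, hU, V, hV, hS, -⟩ := hσ
  obtain ⟨-, U', hU', V', hV', hS', -⟩ := hτ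
  filter_upwards [hV, hV', hc.eventually hU'] with u' h1 h2 h3
  have h4 : σ u' ∈ S u' ∩ U := by rw [hS u' h1]; rfl
  have h5 : σ u' ∈ S u' ∩ U' := ⟨h4.1, h3⟩
  rw [hS' u' h2] at h5
  exact h5

theorem StronglyMetricallyRegular.metricallyRegular {F : X → Set Y} {x : X} {y : Y}
    (h : StronglyMetricallyRegular F x y) : MetricallyRegular F x y := by
  obtain ⟨σ, hσ⟩ := h
  have hσy := hσ.apply_eq
  obtain ⟨hxy, U, hU, V, hV, hS, L, hL⟩ := hσ
  obtain ⟨δ, hδ, hδV⟩ := Metric.mem_nhds_iff.1 hV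
  have hyV : y ∈ V := mem_of_mem_nhds hV
  let R : ℝ≥0 := 1 + L * ⟨δ, hδ.le⟩
  let κ : ℝ≥0 := L + R / ⟨δ / 2, by positivity⟩
  have hκ : (κ : ℝ) = L + (1 + L * δ) / (δ / 2) := rfl
  have hκ0 : (κ : ℝ≥0∞) ≠ 0 := by
    rw [ENNReal.coe_ne_zero, ← NNReal.coe_ne_zero, hκ]
    positivity
  refine ⟨hxy, κ, U ∩ ball x 1, inter_mem hU (ball_mem_nhds x one_pos), ball y (δ / 2),
    ball_mem_nhds y (by positivity), fun x' hx' y' hy' => ?_⟩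
  have hy'V : y' ∈ V := hδV (ball_subset_ball (by linarith) hy')
  have hσmem : σ y' ∈ setInv F y' ∩ U := by rw [hS y' hy'V]; rfl
  refine (infEDist_le_edist_of_mem hσmem.1).trans ?_
  rw [← ENNReal.div_le_iff' hκ0 ENNReal.coe_ne_top, le_infEDist]
  intro y'' hy''
  rw [ENNReal.div_le_iff' hκ0 ENNReal.coe_ne_top, edist_nndist, edist_nndist, ← ENNReal.coe_mul,
    ENNReal.coe_le_coe, ← NNReal.coe_le_coe, NNReal.coe_mul, coe_nndist, coe_nndist, hκ]
  have hδ' : 0 ≤ (1 + L * δ) / (δ / 2) := by positivity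
  by_cases hyV'' : y'' ∈ V
  · have hx'σ : x' ∈ setInv F y'' ∩ U := ⟨hy'', hx'.1⟩
    rw [hS y'' hyV''] at hx'σ
    rw [mem_singleton_iff.1 hx'σ, dist_comm y' y'']
    have := hL.dist_le_mul y'' hyV'' y' hy'V
    rw [add_mul]
    nlinarith [dist_nonneg (x := y'') (y := y')]
  · have h1 : δ / 2 ≤ dist y' y'' := by
      by_contra! h2
      refine hyV'' (hδV ?_)
      rw [mem_ball] at hy' ⊢
      have := dist_triangle y'' y' y
      rw [dist_comm y'' y'] at this
      linarith
    have h2 : dist x' (σ y') ≤ 1 + L * δ := by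
      have h3 := dist_triangle x' x (σ y')
      have h4 := hL.dist_le_mul y hyV y' hy'V
      rw [hσy] at h4
      have h5 : dist x' x < 1 := hx'.2
      have h6 : dist y y' < δ / 2 := by rw [dist_comm]; exact hy'
      have h7 : (L : ℝ) * dist y y' ≤ L * δ :=
        mul_le_mul_of_nonneg_left (by linarith) L.coe_nonneg
      linarith
    have h3 : (1 + L * δ) / (δ / 2) * (δ / 2) = 1 + L * δ := div_mul_cancel₀ _ (by positivity)
    have h4 := mul_le_mul_of_nonneg_left h1 hδ'
    have h5 : 0 ≤ (L : ℝ) * dist y' y'' := by positivity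
    rw [add_mul]
    linarith

variable [InnerProductSpace ℝ X] [InnerProductSpace ℝ Y]

/-- Metric regularity makes the graphical derivative surjective. -/
theorem MetricallyRegular.exists_mem_graphDeriv [FiniteDimensional ℝ X] {F : X → Set Y} {x : X}
    {y : Y} (h : MetricallyRegular F x y) (z : Y) : ∃ w, z ∈ graphDeriv F x y w := by
  obtain ⟨hxy, κ, U, hU, V, hV, hreg⟩ := h
  have ht : Tendsto (fun k : ℕ => 1 / ((k : ℝ) + 1)) atTop (𝓝 0) :=
    tendsto_one_div_add_atTop_nhds_zero_nat
  have hyt : Tendsto (fun k : ℕ => y + (1 / ((k : ℝ) + 1)) • z) atTop (𝓝 y) := by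
    simpa using (ht.smul_const z).const_add y
  obtain ⟨k0, hk0⟩ := eventually_atTop.1 (hyt.eventually hV)
  set t : ℕ → ℝ := fun k => 1 / (((k + k0 : ℕ) : ℝ) + 1) with htdef
  have ht0 : ∀ k, 0 < t k := fun k => by positivity
  have htt : Tendsto t atTop (𝓝 0) := ht.comp (tendsto_add_atTop_nat k0)
  have hex : ∀ k, ∃ w : X, ‖w‖ ≤ κ * ‖z‖ + 1 ∧ y + t k • z ∈ F (x + t k • w) := by
    intro k
    have h1 := hreg x (mem_of_mem_nhds hU) _ (hk0 (k + k0) (Nat.le_add_left _ _))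
    have h2 : infEDist x (setInv F (y + t k • z)) < ENNReal.ofReal ((κ * ‖z‖ + 1) * t k) := by
      refine h1.trans_lt ?_
      calc (κ : ℝ≥0∞) * infEDist (y + t k • z) (F x) ≤ κ * edist (y + t k • z) y := by
            gcongr; exact infEDist_le_edist_of_mem hxy
        _ = ENNReal.ofReal (κ * (t k * ‖z‖)) := by
            rw [edist_dist, dist_eq_norm, add_sub_cancel_left, norm_smul,
              Real.norm_of_nonneg (ht0 k).le, ENNReal.ofReal_mul κ.coe_nonneg,
              ENNReal.ofReal_coe_nnreal]
        _ < _ := by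
            have h0 := ht0 k
            rw [ENNReal.ofReal_lt_ofReal_iff (by positivity)]
            nlinarith
    obtain ⟨x', hx', hlt⟩ := infEDist_lt_iff.1 h2
    refine ⟨(t k)⁻¹ • (x' - x), ?_, ?_⟩
    · rw [edist_dist, ENNReal.ofReal_lt_ofReal_iff (mul_pos (by positivity) (ht0 k)),
        dist_comm, dist_eq_norm] at hlt
      rw [norm_smul, norm_inv, Real.norm_of_nonneg (ht0 k).le, inv_mul_le_iff₀ (ht0 k), mul_comm]
      exact hlt.le
    · rw [smul_smul, mul_inv_cancel₀ (ht0 k).ne', one_smul, add_sub_cancel]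
      exact hx'
  choose w hw hwF using hex
  obtain ⟨w0, -, θ, hθ, hw0⟩ := (isCompact_closedBall (0 : X) (κ * ‖z‖ + 1)).tendsto_subseq
    (fun k => mem_closedBall_zero_iff.2 (hw k))
  refine ⟨w0, fun k => t (θ k), fun k => WithLp.toLp 2 (w (θ k), z), fun k => ht0 _,
    htt.comp hθ.tendsto_atTop, ?_, fun k => hwF (θ k)⟩
  exact ((WithLp.prod_continuous_toLp 2 X Y).tendsto (w0, z)).comp
    (hw0.prodMk_nhds tendsto_const_nhds)

end Regularity

section LinearAlgebra

variable {E : Type*} [NormedAddCommGroup E] [InnerProductSpace ℝ E]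

theorem perp_coe (K : Submodule ℝ E) : perp (K : Set E) = (Kᗮ : Set E) := by
  ext v
  exact (Submodule.mem_orthogonal' K v).symm

variable [FiniteDimensional ℝ E]

theorem inter_eq_zero_iff_add_eq_univ (K : Submodule ℝ E) (A : E →L[ℝ] E) :
    {w | A.adjoint w ∈ perp (K : Set E)} ∩ (K : Set E) = {0} ↔
      A '' (K : Set E) + perp (K : Set E) = Set.univ := by
  have h1 : A '' (K : Set E) + perp (K : Set E) = ((K.map (A : E →ₗ[ℝ] E) ⊔ Kᗮ : Submodule ℝ E) :
      Set E) := by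
    rw [perp_coe, Submodule.coe_sup, Submodule.map_coe]; rfl
  have h2 : {w | A.adjoint w ∈ perp (K : Set E)} ∩ (K : Set E) =
      (((K.map (A : E →ₗ[ℝ] E) ⊔ Kᗮ)ᗮ : Submodule ℝ E) : Set E) := by
    rw [← Submodule.inf_orthogonal, Submodule.orthogonal_orthogonal, Submodule.coe_inf]
    congr 1
    ext w
    simp only [mem_ofPred_eq, perp, SetLike.mem_coe, Submodule.mem_orthogonal', Submodule.mem_map,
      forall_exists_index, and_imp, forall_apply_eq_imp_iff₂, ContinuousLinearMap.coe_coe,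
      ContinuousLinearMap.adjoint_inner_left]
  rw [h1, h2, ← Submodule.bot_coe (R := ℝ), SetLike.coe_set_eq, Submodule.orthogonal_eq_bot_iff,
    ← Submodule.top_coe (R := ℝ), SetLike.coe_set_eq]

theorem eq_zero_of_add_eq_univ {K : Submodule ℝ E} {A : E →L[ℝ] E}
    (h : A '' (K : Set E) + perp (K : Set E) = Set.univ) {w : E} (hw : w ∈ K)
    (hAw : A w ∈ Kᗮ) : w = 0 := by
  obtain ⟨T, hT⟩ : ∃ T : K →ₗ[ℝ] K, ∀ y : K, T y = K.orthogonalProjectionOnto (A y) :=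
    ⟨((K.orthogonalProjectionOnto ∘L A : E →L[ℝ] K) : E →ₗ[ℝ] K) ∘ₗ K.subtype, fun _ => rfl⟩
  have hsurj : Function.Surjective T := by
    intro y
    have hy : (y : E) ∈ A '' (K : Set E) + perp (K : Set E) := h ▸ mem_univ _
    obtain ⟨_, ⟨w', hw', rfl⟩, v, hv, hsum⟩ := hy
    rw [perp_coe] at hv
    refine ⟨⟨w', hw'⟩, ?_⟩
    have h1 := congrArg K.orthogonalProjectionOnto hsum
    rw [map_add, K.orthogonalProjectionOnto_mem_subspace_eq_self,
      Submodule.orthogonalProjectionOnto_eq_zero_iff.2 hv, add_zero] at h1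
    rw [hT, h1]
  have hinj := LinearMap.injective_iff_surjective.2 hsurj
  have h0 : T ⟨w, hw⟩ = T 0 := by
    rw [map_zero, hT]
    exact Submodule.orthogonalProjectionOnto_eq_zero_iff.2 hAw
  simpa using hinj h0

end LinearAlgebra

section KKT

variable {E F : Type*} [NormedAddCommGroup E] [InnerProductSpace ℝ E] [FiniteDimensional ℝ E]
  [NormedAddCommGroup F] [InnerProductSpace ℝ F] [FiniteDimensional ℝ F]

/-- Locally around `x0` and `f x0 + ∇Φ(x0)* l0`, the graph of `G` is described by the system
`u = f x + ∇Φ(x)* (l0 + η)`, `Φ x - Φ x0 ∈ Nᗮ`, with a small multiplier `η ∈ N`. -/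
structure HasKKTGraph (G : E → Set E) (f : E → E) (Φ : E → F) (N : Submodule ℝ F) (x0 : E)
    (l0 : F) : Prop where
  of_mem : ∀ ε : ℝ, 0 < ε → ∀ᶠ p in 𝓝 (x0, f x0 + (fderiv ℝ Φ x0).adjoint l0), p.2 ∈ G p.1 →
    N.orthogonalProjectionOnto (Φ p.1 - Φ x0) = 0 ∧
      ∃ η ∈ N, ‖η‖ < ε ∧ p.2 = f p.1 + (fderiv ℝ Φ p.1).adjoint (l0 + η)
  mem : ∃ r : ℝ, 0 < r ∧ ∀ᶠ x in 𝓝 x0, N.orthogonalProjectionOnto (Φ x - Φ x0) = 0 →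
    ∀ η ∈ N, ‖η‖ < r → f x + (fderiv ℝ Φ x).adjoint (l0 + η) ∈ G x

/-- Taking adjoints, as a continuous linear map over the reals. -/
noncomputable def adjointCLM : (E →L[ℝ] F) →L[ℝ] (F →L[ℝ] E) :=
  LinearMap.toContinuousLinearMap
    { toFun := fun T => T.adjoint
      map_add' := fun S T => map_add _ S T
      map_smul' := fun c T => by simp }

theorem contDiffAt_adjoint_fderiv {Φ : E → F} {x0 : E} (hΦ : ContDiffAt ℝ 2 Φ x0) :
    ContDiffAt ℝ 1 (fun x => (fderiv ℝ Φ x).adjoint) x0 :=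
  (adjointCLM (E := E) (F := F)).contDiff.contDiffAt.comp x0
    (hΦ.fderiv_right (m := 1) (by norm_num))

/-- The graphical derivative of a mapping with a KKT graph. -/
theorem HasKKTGraph.of_mem_graphDeriv {G : E → Set E} {f : E → E} {Φ : E → F}
    {N : Submodule ℝ F} {x0 : E} {l0 : F} (hG : HasKKTGraph G f Φ N x0 l0)
    (hΦ : ContDiffAt ℝ 2 Φ x0) {A : E →L[ℝ] E}
    (hA : HasFDerivAt (fun x => f x + (fderiv ℝ Φ x).adjoint l0) A x0) {w z : E}
    (hz : z ∈ graphDeriv G x0 (f x0 + (fderiv ℝ Φ x0).adjoint l0) w) :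
    N.orthogonalProjectionOnto (fderiv ℝ Φ x0 w) = 0 ∧
      ∀ w', N.orthogonalProjectionOnto (fderiv ℝ Φ x0 w') = 0 → inner ℝ (z - A w) w' = 0 := by
  obtain ⟨t, ζ, ht, ht0, hζ, hmem⟩ := hz
  have hw : Tendsto (fun k => (ζ k).fst) atTop (𝓝 w) :=
    ((WithLp.fstL 2 ℝ E E).continuous.tendsto _).comp hζ
  have hz : Tendsto (fun k => (ζ k).snd) atTop (𝓝 z) :=
    ((WithLp.sndL 2 ℝ E E).continuous.tendsto _).comp hζ
  set u0 := f x0 + (fderiv ℝ Φ x0).adjoint l0 with hu0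
  have hp : Tendsto (fun k => (x0 + t k • (ζ k).fst, u0 + t k • (ζ k).snd)) atTop
      (𝓝 (x0, u0)) := by
    refine Tendsto.prodMk_nhds ?_ ?_
    · simpa using (ht0.smul hw).const_add x0
    · simpa using (ht0.smul hz).const_add u0
  have hmem' : ∀ k, u0 + t k • (ζ k).snd ∈ G (x0 + t k • (ζ k).fst) := hmem
  have hΦd := (hΦ.differentiableAt two_ne_zero).hasFDerivAt
  refine ⟨?_, fun w' hw' => ?_⟩
  · have hlim := (N.orthogonalProjectionOnto.continuous.tendsto _).comp
      (tendsto_quotient_of_hasFDerivAt hΦd (.of_forall ht) ht0 hw)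
    refine tendsto_nhds_unique hlim (tendsto_const_nhds.congr' ?_)
    filter_upwards [hp.eventually (hG.of_mem 1 one_pos)] with k hk
    rw [Function.comp, map_smul, (hk (hmem' k)).1, smul_zero]
  · have hd : HasFDerivAt (fun x => fderiv ℝ Φ x w') ((fderiv ℝ (fderiv ℝ Φ) x0).flip w') x0 := by
      have h1 : HasFDerivAt (fderiv ℝ Φ) (fderiv ℝ (fderiv ℝ Φ) x0) x0 :=
        ((hΦ.fderiv_right (m := 1) (by norm_num)).differentiableAt one_ne_zero).hasFDerivAt
      simpa using h1.clm_apply (hasFDerivAt_const w' x0)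
    set b := (fderiv ℝ (fderiv ℝ Φ) x0).flip w' w with hb
    have hlim1 := tendsto_quotient_of_hasFDerivAt hd (.of_forall ht) ht0 hw
    have hlim2 := tendsto_quotient_of_hasFDerivAt hA (.of_forall ht) ht0 hw
    have hle : ∀ ε : ℝ, 0 < ε → |inner ℝ (z - A w) w'| ≤ ε * ‖b‖ := by
      intro ε hε
      refine le_of_tendsto_of_tendsto
        ((((hz.sub hlim2).inner (tendsto_const_nhds (x := w')))).abs)
        ((hlim1.norm).const_mul ε) ?_
      filter_upwards [hp.eventually (hG.of_mem ε hε)] with k hk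
      obtain ⟨-, η, hη, hηε, heq⟩ := hk (hmem' k)
      set xk := x0 + t k • (ζ k).fst with hxk
      have h1 : (ζ k).snd - (t k)⁻¹ • ((f xk + (fderiv ℝ Φ xk).adjoint l0) -
          (f x0 + (fderiv ℝ Φ x0).adjoint l0)) = (t k)⁻¹ • (fderiv ℝ Φ xk).adjoint η := by
        have h2 : t k • (ζ k).snd = (f xk + (fderiv ℝ Φ xk).adjoint l0) - u0 +
            (fderiv ℝ Φ xk).adjoint η := by
          rw [map_add] at heq
          rw [← add_right_inj u0, heq]; abel
        have h3 : (ζ k).snd = (t k)⁻¹ • (t k • (ζ k).snd) := by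
          rw [smul_smul, inv_mul_cancel₀ (ht k).ne', one_smul]
        rw [h3, h2, ← hu0, smul_add]; abel
      have h4 : inner ℝ η (fderiv ℝ Φ x0 w') = 0 := by
        have := N.inner_orthogonalProjectionOnto_eq_of_mem_left ⟨η, hη⟩ (fderiv ℝ Φ x0 w')
        rw [hw', inner_zero_right] at this
        exact this.symm
      have h5 : inner ℝ ((t k)⁻¹ • (fderiv ℝ Φ xk).adjoint η) w' =
          inner ℝ η ((t k)⁻¹ • (fderiv ℝ Φ xk w' - fderiv ℝ Φ x0 w')) := by
        rw [real_inner_smul_left, ContinuousLinearMap.adjoint_inner_left, real_inner_smul_right,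
          inner_sub_right, h4, sub_zero]
      show |inner ℝ ((ζ k).snd - (t k)⁻¹ • ((f xk + (fderiv ℝ Φ xk).adjoint l0) -
          (f x0 + (fderiv ℝ Φ x0).adjoint l0))) w'| ≤ _
      rw [h1, h5]
      exact (abs_real_inner_le_norm _ _).trans (by gcongr)
    have hzero : |inner ℝ (z - A w) w'| ≤ 0 := by
      have hlim : Tendsto (fun ε : ℝ => ε * ‖b‖) (𝓝[>] 0) (𝓝 0) := by
        have : Tendsto (fun ε : ℝ => ε) (𝓝[>] 0) (𝓝 0) :=
          tendsto_id.mono_left nhdsWithin_le_nhds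
        simpa using this.mul_const ‖b‖
      exact ge_of_tendsto hlim (by filter_upwards [self_mem_nhdsWithin] with ε hε using hle ε hε)
    exact abs_nonpos_iff.1 hzero

/-- The inverse function theorem for the KKT system. -/
theorem HasKKTGraph.exists_localization {G : E → Set E} {f : E → E} {Φ : E → F}
    {N : Submodule ℝ F} {x0 : E} {l0 : F} (hG : HasKKTGraph G f Φ N x0 l0)
    (hf : ContDiffAt ℝ 1 f x0) (hΦ : ContDiffAt ℝ 2 Φ x0)
    (hinj : ∀ η ∈ N, (fderiv ℝ Φ x0).adjoint η = 0 → η = 0) {A : E →L[ℝ] E}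
    (hA : HasFDerivAt (fun x => f x + (fderiv ℝ Φ x).adjoint l0) A x0)
    (hreg : ∀ w, N.orthogonalProjectionOnto (fderiv ℝ Φ x0 w) = 0 →
      (∀ w', N.orthogonalProjectionOnto (fderiv ℝ Φ x0 w') = 0 → inner ℝ (A w) w' = 0) → w = 0) :
    ∃ σ : E → E,
      IsLipschitzLocalization (setInv G) (f x0 + (fderiv ℝ Φ x0).adjoint l0) x0 σ ∧
      ContDiffAt ℝ 1 σ (f x0 + (fderiv ℝ Φ x0).adjoint l0) ∧
      ∀ z, N.orthogonalProjectionOnto (fderiv ℝ Φ x0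
          (fderiv ℝ σ (f x0 + (fderiv ℝ Φ x0).adjoint l0) z)) = 0 ∧
        ∀ w', N.orthogonalProjectionOnto (fderiv ℝ Φ x0 w') = 0 →
          inner ℝ (z - A (fderiv ℝ σ (f x0 + (fderiv ℝ Φ x0).adjoint l0) z)) w' = 0 := by
  set u0 := f x0 + (fderiv ℝ Φ x0).adjoint l0 with hu0
  set P := N.orthogonalProjectionOnto with hP
  let M : E × N → E × N := fun p =>
    (f p.1 + (fderiv ℝ Φ p.1).adjoint l0 + (fderiv ℝ Φ p.1).adjoint p.2, P (Φ p.1 - Φ x0))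
  have hMp : ∀ p : E × N, M p = (f p.1 + (fderiv ℝ Φ p.1).adjoint (l0 + p.2),
      P (Φ p.1 - Φ x0)) := fun p => by simp only [M, map_add, add_assoc]
  have hM0 : M (x0, 0) = (u0, 0) := by simp [M, hu0]
  have hadj := contDiffAt_adjoint_fderiv hΦ
  have hΦ1 : ContDiffAt ℝ 1 Φ x0 := hΦ.of_le (by norm_num)
  have hMc : ContDiffAt ℝ 1 M (x0, 0) := by
    have h1 : ContDiffAt ℝ 1 (fun p : E × N => f p.1) (x0, 0) :=
      ContDiffAt.comp (x0, (0 : N)) (f := Prod.fst) hf contDiffAt_fst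
    have h2 : ContDiffAt ℝ 1 (fun p : E × N => (fderiv ℝ Φ p.1).adjoint) (x0, 0) :=
      ContDiffAt.comp (x0, (0 : N)) (f := Prod.fst) hadj contDiffAt_fst
    have h3 : ContDiffAt ℝ 1 (fun p : E × N => Φ p.1 - Φ x0) (x0, 0) :=
      (ContDiffAt.comp (x0, (0 : N)) (f := Prod.fst) hΦ1 contDiffAt_fst).sub contDiffAt_const
    have h4 : ContDiffAt ℝ 1 (fun p : E × N => (p.2 : F)) (x0, 0) :=
      N.subtypeL.contDiff.contDiffAt.comp (x0, (0 : N)) contDiffAt_snd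
    exact ((h1.add (h2.clm_apply contDiffAt_const)).add (h2.clm_apply h4)).prodMk
      (P.contDiff.contDiffAt.comp (x0, (0 : N)) h3)
  let M' : E × N →L[ℝ] E × N :=
    (A ∘L ContinuousLinearMap.fst ℝ E N + (fderiv ℝ Φ x0).adjoint ∘L N.subtypeL ∘L
      ContinuousLinearMap.snd ℝ E N).prod ((P ∘L fderiv ℝ Φ x0) ∘L ContinuousLinearMap.fst ℝ E N)
  have hM' : HasFDerivAt M M' (x0, 0) := by
    have h1 : HasFDerivAt (fun p : E × N => f p.1 + (fderiv ℝ Φ p.1).adjoint l0)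
        (A ∘L ContinuousLinearMap.fst ℝ E N) (x0, 0) :=
      HasFDerivAt.comp (x0, (0 : N)) (f := Prod.fst) hA hasFDerivAt_fst
    have h2 : HasFDerivAt (fun p : E × N => (fderiv ℝ Φ p.1).adjoint)
        ((fderiv ℝ (fun x => (fderiv ℝ Φ x).adjoint) x0) ∘L ContinuousLinearMap.fst ℝ E N)
        (x0, 0) :=
      HasFDerivAt.comp (x0, (0 : N)) (f := Prod.fst)
        (hadj.differentiableAt one_ne_zero).hasFDerivAt hasFDerivAt_fst
    have h3 : HasFDerivAt (fun p : E × N => Φ p.1 - Φ x0)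
        (fderiv ℝ Φ x0 ∘L ContinuousLinearMap.fst ℝ E N) (x0, 0) :=
      (HasFDerivAt.comp (x0, (0 : N)) (f := Prod.fst)
        (hΦ1.differentiableAt one_ne_zero).hasFDerivAt hasFDerivAt_fst).sub_const _
    have h4 : HasFDerivAt (fun p : E × N => (p.2 : F))
        (N.subtypeL ∘L ContinuousLinearMap.snd ℝ E N) (x0, 0) :=
      (N.subtypeL ∘L ContinuousLinearMap.snd ℝ E N).hasFDerivAt
    refine ((h1.add (h2.clm_apply h4)).prodMk
      (P.hasFDerivAt.comp (x0, (0 : N)) h3)).congr_fderiv ?_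
    ext p <;> simp [M']
  have hM'inj : Function.Injective M' := by
    refine (injective_iff_map_eq_zero _).2 fun p hp => ?_
    have h1 : A p.1 + (fderiv ℝ Φ x0).adjoint p.2 = 0 := congrArg Prod.fst hp
    have h2 : P (fderiv ℝ Φ x0 p.1) = 0 := congrArg Prod.snd hp
    have h3 : p.1 = 0 := by
      refine hreg _ h2 fun w' hw' => ?_
      rw [eq_neg_of_add_eq_zero_left h1, inner_neg_left, ContinuousLinearMap.adjoint_inner_left,
        ← N.inner_orthogonalProjectionOnto_eq_of_mem_left, ← hP, hw', inner_zero_right, neg_zero]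
    rw [h3, map_zero, zero_add] at h1
    exact Prod.ext h3 (Subtype.ext (hinj _ p.2.2 h1))
  let e : (E × N) ≃L[ℝ] (E × N) :=
    (LinearEquiv.ofInjectiveEndo (M' : E × N →ₗ[ℝ] E × N) hM'inj).toContinuousLinearEquiv
  have he : (e : E × N →L[ℝ] E × N) = M' := by
    ext p <;> rfl
  rw [← he] at hM'
  have hMs := hMc.hasStrictFDerivAt' hM' one_ne_zero
  set τ := hMc.localInverse hM' one_ne_zero with hτ
  have hτc : ContDiffAt ℝ 1 τ (u0, 0) := hM0 ▸ hMc.to_localInverse hM' one_ne_zero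
  have hτd : HasFDerivAt τ (e.symm : E × N →L[ℝ] E × N) (u0, 0) :=
    hM0 ▸ hMs.to_localInverse.hasFDerivAt
  have hτ0 : τ (u0, 0) = (x0, 0) := hM0 ▸ hMc.localInverse_apply_image hM' one_ne_zero
  have hleft : ∀ᶠ p in 𝓝 ((x0, 0) : E × N), τ (M p) = p := hMs.eventually_left_inverse
  have hright : ∀ᶠ q in 𝓝 ((u0, 0) : E × N), M (τ q) = q := hM0 ▸ hMs.eventually_right_inverse
  let ι : E → E × N := fun u => (u, 0)
  have hιc : ContDiffAt ℝ 1 ι u0 := contDiffAt_id.prodMk contDiffAt_const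
  have hιt : Tendsto ι (𝓝 u0) (𝓝 (u0, 0)) := hιc.continuousAt.tendsto
  have hτι : ContDiffAt ℝ 1 (fun u => τ (u, 0)) u0 := ContDiffAt.comp u0 (f := ι) hτc hιc
  have hτιt : Tendsto (fun u => τ (u, 0)) (𝓝 u0) (𝓝 (x0, 0)) := hτ0 ▸ hτι.continuousAt.tendsto
  let σ : E → E := fun u => (τ (u, 0)).1
  have hσc : ContDiffAt ℝ 1 σ u0 := contDiffAt_fst.comp u0 hτι
  have hσd : HasFDerivAt σ (ContinuousLinearMap.fst ℝ E N ∘L (e.symm : E × N →L[ℝ] E × N) ∘L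
      ContinuousLinearMap.inl ℝ E N) u0 := by
    have h1 : HasFDerivAt ι (ContinuousLinearMap.inl ℝ E N) u0 :=
      (ContinuousLinearMap.inl ℝ E N).hasFDerivAt
    exact hasFDerivAt_fst.comp u0 (HasFDerivAt.comp u0 (f := ι) hτd h1)
  obtain ⟨r, hr, hGmem⟩ := hG.mem
  have hsol : ∀ᶠ u in 𝓝 u0, u ∈ G (σ u) := by
    have h1 : Tendsto σ (𝓝 u0) (𝓝 x0) := (continuous_fst.tendsto (x0, (0 : N))).comp hτιt
    have h2 : ∀ᶠ u in 𝓝 u0, ‖((τ (u, 0)).2 : F)‖ < r := by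
      have h3 : Tendsto (fun u => ‖((τ (u, 0)).2 : F)‖) (𝓝 u0) (𝓝 0) := by
        have h4 : Continuous fun p : E × N => ‖(p.2 : F)‖ := by fun_prop
        have h5 := (h4.tendsto (x0, 0)).comp hτιt
        rwa [Submodule.coe_zero, norm_zero] at h5
      exact h3.eventually_lt_const hr
    filter_upwards [hιt.eventually hright, h1.eventually hGmem, h2] with u hu1 hu2 hu3
    have hu1' := (hMp _).symm.trans hu1
    have h4 := hu2 (congrArg Prod.snd hu1') _ (τ (u, 0)).2.2 hu3
    have h5 : f (σ u) + (fderiv ℝ Φ (σ u)).adjoint (l0 + (τ (u, 0)).2) = u :=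
      congrArg Prod.fst hu1'
    rwa [h5] at h4
  have huniq : ∀ᶠ p in 𝓝 (x0, u0), p.2 ∈ G p.1 → p.1 = σ p.2 := by
    obtain ⟨ε, hε, hball⟩ := Metric.eventually_nhds_iff_ball.1 hleft
    have hfst : ∀ᶠ p in 𝓝 (x0, u0), dist p.1 x0 < ε :=
      (continuousAt_fst (p := (x0, u0))).tendsto (ball_mem_nhds x0 hε)
    filter_upwards [hG.of_mem ε hε, hfst] with p hp hp' hmem
    obtain ⟨h1, η, hη, hηε, heq⟩ := hp hmem
    have h2 := hball (p.1, ⟨η, hη⟩) (by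
      rw [mem_ball, Prod.dist_eq, max_lt_iff]
      exact ⟨hp', by simpa using hηε⟩)
    rw [hMp, ← heq, h1] at h2
    exact (congrArg Prod.fst h2).symm
  obtain ⟨L, V1, hV1, hLip⟩ := hσc.exists_lipschitzOnWith
  rw [nhds_prod_eq] at huniq
  obtain ⟨U, hU, V2, hV2, hUV⟩ := mem_prod_iff.1 huniq
  have hσ0 : σ u0 = x0 := congrArg Prod.fst hτ0
  have hσU : ∀ᶠ u in 𝓝 u0, σ u ∈ U :=
    hσc.continuousAt.eventually (by rwa [hσ0])
  refine ⟨σ, ⟨?_, U, hU, V1 ∩ V2 ∩ {u | u ∈ G (σ u)} ∩ {u | σ u ∈ U},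
    inter_mem (inter_mem (inter_mem hV1 hV2) hsol) hσU, ?_, L, hLip.mono fun u hu => hu.1.1.1⟩,
    hσc, fun z => ?_⟩
  · have := hsol.self_of_nhds
    rwa [hσ0] at this
  · rintro u ⟨⟨⟨-, hu2⟩, hu3⟩, hu4⟩
    refine Subset.antisymm ?_ (singleton_subset_iff.2 ⟨hu3, hu4⟩)
    rintro x ⟨hx1, hx2⟩
    exact @hUV (x, u) ⟨hx2, hu2⟩ hx1
  · rw [hσd.fderiv]
    set p := e.symm (z, 0) with hp
    have h1 : M' p = (z, 0) := by
      rw [← he]; exact e.apply_symm_apply _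
    have h2 : A p.1 + (fderiv ℝ Φ x0).adjoint p.2 = z := congrArg Prod.fst h1
    have h3 : P (fderiv ℝ Φ x0 p.1) = 0 := congrArg Prod.snd h1
    refine ⟨h3, fun w' hw' => ?_⟩
    show inner ℝ (z - A p.1) w' = 0
    rw [← h2, add_sub_cancel_left, ContinuousLinearMap.adjoint_inner_left,
      ← N.inner_orthogonalProjectionOnto_eq_of_mem_left, ← hP, hw', inner_zero_right]

end KKT

section Euclidean

variable {n m : ℕ}

theorem hasFDerivAt_add_adjoint {f : EuclideanSpace ℝ (Fin n) → EuclideanSpace ℝ (Fin n)}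
    {Φ : EuclideanSpace ℝ (Fin n) → EuclideanSpace ℝ (Fin m)} {x0 : EuclideanSpace ℝ (Fin n)}
    (hf : DifferentiableAt ℝ f x0) (hΦ : ContDiffAt ℝ 2 Φ x0) (l : EuclideanSpace ℝ (Fin m)) :
    HasFDerivAt (fun x => f x + (fderiv ℝ Φ x).adjoint l) (fderiv ℝ f x0 + hessian Φ l x0) x0 := by
  have hgrad : (fun x => (fderiv ℝ Φ x).adjoint l) =ᶠ[𝓝 x0]
      gradient fun y => inner ℝ l (Φ y) := by
    filter_upwards [hΦ.eventually (by simp)] with x hx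
    refine (HasGradientAt.gradient ?_).symm
    rw [hasGradientAt_iff_hasFDerivAt]
    refine ((innerSL ℝ l).hasFDerivAt.comp x
      (hx.differentiableAt two_ne_zero).hasFDerivAt).congr_fderiv ?_
    ext w
    simp [ContinuousLinearMap.adjoint_inner_left]
  have hd : DifferentiableAt ℝ (fun x => (fderiv ℝ Φ x).adjoint l) x0 :=
    ((contDiffAt_adjoint_fderiv hΦ).clm_apply contDiffAt_const).differentiableAt one_ne_zero
  refine hf.hasFDerivAt.add ?_
  rw [hessian, ← hgrad.fderiv_eq]
  exact hd.hasFDerivAt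

theorem stdMatrix_mulVec (T : EuclideanSpace ℝ (Fin n) →L[ℝ] EuclideanSpace ℝ (Fin m))
    (x : EuclideanSpace ℝ (Fin n)) : (stdMatrix T).mulVec x.ofLp = (T x).ofLp := by
  have hx : x = ∑ j, x j • EuclideanSpace.single j (1 : ℝ) := by
    ext i
    simp [Finset.sum_apply, Pi.single_apply]
  ext i
  conv_rhs => rw [hx]
  simp [stdMatrix, Matrix.mulVec, dotProduct, mul_comm]

/-- The reduced inverse formula for an operator characterized by projected equations. -/
theorem reducedInverseFormula_of_projected {K : Submodule ℝ (EuclideanSpace ℝ (Fin n))}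
    {A D : EuclideanSpace ℝ (Fin n) →L[ℝ] EuclideanSpace ℝ (Fin n)}
    (hreg : ∀ w ∈ K, A w ∈ Kᗮ → w = 0) (hD : ∀ z, D z ∈ K) (hAD : ∀ z, z - A (D z) ∈ Kᗮ) :
    ReducedInverseFormula (K : Set (EuclideanSpace ℝ (Fin n))) A D := by
  rintro s B ⟨hli, hspan⟩
  have hBc : ∀ c : Fin s → ℝ, (WithLp.toLp 2 (B.mulVec c) : EuclideanSpace ℝ (Fin n)) =
      ∑ j, c j • (WithLp.toLp 2 (B.col j) : EuclideanSpace ℝ (Fin n)) := by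
    intro c
    ext i
    simp [Matrix.mulVec, dotProduct, mul_comm]
  have hBK : ∀ c : Fin s → ℝ, (WithLp.toLp 2 (B.mulVec c) : EuclideanSpace ℝ (Fin n)) ∈ K := by
    intro c
    rw [← SetLike.mem_coe, ← hspan, hBc]
    exact Submodule.sum_mem _ fun j _ => Submodule.smul_mem _ _ (Submodule.subset_span ⟨j, rfl⟩)
  have hKB : ∀ w ∈ K, ∃ c : Fin s → ℝ, B.mulVec c = w.ofLp := by
    intro w hw
    rw [← SetLike.mem_coe, ← hspan, SetLike.mem_coe, Submodule.mem_span_range_iff_exists_fun] at hw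
    obtain ⟨c, hc⟩ := hw
    exact ⟨c, by rw [← hc, ← hBc]⟩
  have hcol : ∀ (y : EuclideanSpace ℝ (Fin n)) (j : Fin s), B.transpose.mulVec y.ofLp j =
      inner ℝ y (WithLp.toLp 2 (B.col j) : EuclideanSpace ℝ (Fin n)) := by
    intro y j
    simp [Matrix.mulVec, dotProduct, PiLp.inner_apply]
  have hBT : ∀ y : EuclideanSpace ℝ (Fin n), B.transpose.mulVec y.ofLp = 0 ↔ y ∈ Kᗮ := by
    intro y
    rw [Submodule.mem_orthogonal']
    constructor
    · intro h w hw
      obtain ⟨c, hc⟩ := hKB w hw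
      have hw' : w = WithLp.toLp 2 (B.mulVec c) := by rw [hc]
      rw [hw', hBc, inner_sum]
      refine Finset.sum_eq_zero fun j _ => ?_
      rw [real_inner_smul_right, ← hcol, h]
      simp
    · intro h
      ext j
      rw [hcol]
      refine h _ ?_
      rw [← SetLike.mem_coe, ← hspan]
      exact Submodule.subset_span ⟨j, rfl⟩
  have hmul : ∀ c : Fin s → ℝ, (B.transpose * stdMatrix A * B).mulVec c =
      B.transpose.mulVec (A (WithLp.toLp 2 (B.mulVec c))).ofLp := by
    intro c
    rw [← stdMatrix_mulVec, Matrix.mulVec_mulVec, Matrix.mulVec_mulVec, Matrix.mul_assoc]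
  have hunit : IsUnit (B.transpose * stdMatrix A * B) := by
    rw [← Matrix.mulVec_injective_iff_isUnit]
    intro c c' hcc
    have h0 : (B.transpose * stdMatrix A * B).mulVec (c - c') = 0 := by
      rw [Matrix.mulVec_sub]; exact sub_eq_zero.2 hcc
    rw [hmul, hBT] at h0
    have h1 := hreg _ (hBK _) h0
    rw [hBc] at h1
    have h2 := Fintype.linearIndependent_iff.1 hli _ h1
    exact funext fun j => sub_eq_zero.1 (h2 j)
  refine ⟨hunit, Matrix.toLin'.injective (LinearMap.ext fun z => ?_)⟩
  rw [Matrix.toLin'_apply, Matrix.toLin'_apply]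
  obtain ⟨c, hc⟩ := hKB _ (hD (WithLp.toLp 2 z))
  have h1 := (hBT _).2 (hAD (WithLp.toLp 2 z))
  have h2 : B.transpose.mulVec z = (B.transpose * stdMatrix A * B).mulVec c := by
    rw [hmul, hc]
    rw [WithLp.ofLp_sub, Matrix.mulVec_sub] at h1
    exact sub_eq_zero.1 h1
  rw [← Matrix.mulVec_mulVec, ← Matrix.mulVec_mulVec, h2, Matrix.mulVec_mulVec c,
    Matrix.nonsing_inv_mul _ ((Matrix.isUnit_iff_isUnit_det _).1 hunit), Matrix.one_mulVec, hc,
    ← stdMatrix_mulVec]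

theorem mem_geMap_iff {f : EuclideanSpace ℝ (Fin n) → EuclideanSpace ℝ (Fin n)}
    {φ : EuclideanSpace ℝ (Fin n) → EReal} {x u : EuclideanSpace ℝ (Fin n)} :
    u ∈ geMap f φ x ↔ u - f x ∈ subdiff φ x := by
  constructor
  · rintro ⟨v, hv, rfl⟩
    simpa using hv
  · intro h
    exact ⟨_, h, by simp⟩

/-- At a nondegenerate point, the generalized equation is locally a KKT system. -/
theorem hasKKTGraph_geMap {φ : EuclideanSpace ℝ (Fin n) → EReal}
    {g : EuclideanSpace ℝ (Fin m) → EReal}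
    {Φ : EuclideanSpace ℝ (Fin n) → EuclideanSpace ℝ (Fin m)}
    {f : EuclideanSpace ℝ (Fin n) → EuclideanSpace ℝ (Fin n)}
    {x0 : EuclideanSpace ℝ (Fin n)} {l0 : EuclideanSpace ℝ (Fin m)}
    (hg : IsPolyhedralFun g) (hΦ : ContDiffAt ℝ 1 Φ x0) (hφ : ∀ᶠ x in 𝓝 x0, φ x = g (Φ x))
    (hf : ContinuousAt f x0) {N : Submodule ℝ (EuclideanSpace ℝ (Fin m))}
    (hN : N = vectorSpan ℝ (subdiff g (Φ x0)))
    (hinj : ∀ η ∈ N, (fderiv ℝ Φ x0).adjoint η = 0 → η = 0) {r : ℝ} (hr : 0 < r)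
    (hri : ∀ η ∈ N, ‖η‖ < r → l0 + η ∈ subdiff g (Φ x0)) :
    HasKKTGraph (geMap f φ) f Φ N x0 l0 where
  of_mem ε hε := by
    have ht : Tendsto (fun p : EuclideanSpace ℝ (Fin n) × EuclideanSpace ℝ (Fin n) =>
        (p.1, p.2 - f p.1)) (𝓝 (x0, f x0 + (fderiv ℝ Φ x0).adjoint l0))
        (𝓝 (x0, (fderiv ℝ Φ x0).adjoint l0)) := by
      have h1 := continuousAt_fst (p := (x0, f x0 + (fderiv ℝ Φ x0).adjoint l0))
      have h2 := continuousAt_snd (p := (x0, f x0 + (fderiv ℝ Φ x0).adjoint l0))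
      have h3 := h2.tendsto.sub (hf.tendsto.comp h1)
      simp only [add_sub_cancel_left] at h3
      exact h1.tendsto.prodMk_nhds h3
    filter_upwards [ht.eventually (eventually_of_mem_subdiff_comp hg hΦ hφ hN hinj hr hri hε)]
      with p hp hmem
    obtain ⟨h1, η, hη, hηε, heq⟩ := hp (mem_geMap_iff.1 hmem)
    exact ⟨h1, η, hη, hηε, sub_eq_iff_eq_add'.1 heq⟩
  mem := by
    have hl0 : l0 ∈ subdiff g (Φ x0) := by simpa using hri 0 N.zero_mem (by simpa using hr)
    obtain ⟨α0, hα0⟩ := exists_real_of_ne hl0.1 hl0.2.1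
    refine ⟨r, hr, ?_⟩
    filter_upwards [eventually_mem_subdiff_comp hg hΦ hφ hα0 hN hinj hr hri] with x hx hP η hη hηr
    exact mem_geMap_iff.2 (by simpa using (hx hP).2 η hη hηr)

end Euclidean

end VarAn

theorem theorem4p3 {n m : ℕ}
    (φ : EuclideanSpace ℝ (Fin n) → EReal)
    (g : EuclideanSpace ℝ (Fin m) → EReal)
    (Φ : EuclideanSpace ℝ (Fin n) → EuclideanSpace ℝ (Fin m))
    (f : EuclideanSpace ℝ (Fin n) → EuclideanSpace ℝ (Fin n))
    (xbar ubar : EuclideanSpace ℝ (Fin n)) (lbar : EuclideanSpace ℝ (Fin m))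
    (hg : VarAn.IsPolyhedralFun g)
    (hΦ : ContDiffAt ℝ 2 Φ xbar)
    (hφ : ∀ᶠ x in 𝓝 xbar, φ x = g (Φ x))
    (hf : ContDiff ℝ 1 f)
    (hnd : ubar - f xbar ∈ intrinsicInterior ℝ (VarAn.subdiff φ xbar))
    (hl : lbar ∈ VarAn.multipliers g Φ xbar (ubar - f xbar))
    (hsoqc : VarAn.SOQC g Φ xbar lbar)
    (K : Set (EuclideanSpace ℝ (Fin n)))
    (hK : K = VarAn.criticalCone φ xbar (ubar - f xbar))
    (A : EuclideanSpace ℝ (Fin n) →L[ℝ] EuclideanSpace ℝ (Fin n))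
    (hA : A = fderiv ℝ f xbar + VarAn.hessian Φ lbar xbar) :
    VarAn.multipliers g Φ xbar (ubar - f xbar) = {lbar} ∧
    (∃ L : Submodule ℝ (EuclideanSpace ℝ (Fin n)), (L : Set (EuclideanSpace ℝ (Fin n))) = K) ∧
    (VarAn.MetricallyRegular (VarAn.geMap f φ) xbar ubar ↔
      VarAn.StronglyMetricallyRegular (VarAn.geMap f φ) xbar ubar) ∧
    [ VarAn.MetricallyRegular (VarAn.geMap f φ) xbar ubar,
      {w | A.adjoint w ∈ VarAn.perp K} ∩ K = {0},
      A '' K + VarAn.perp K = Set.univ,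
      ∀ z, ∃ w, z ∈ VarAn.graphDeriv (VarAn.geMap f φ) xbar ubar w,
      ∃ σ : EuclideanSpace ℝ (Fin n) → EuclideanSpace ℝ (Fin n),
        VarAn.IsLipschitzLocalization (VarAn.setInv (VarAn.geMap f φ)) ubar xbar σ ∧
        ContDiffAt ℝ 1 σ ubar ∧
        VarAn.ReducedInverseFormula K A (fderiv ℝ σ ubar)].TFAE ∧
    (∀ σ : EuclideanSpace ℝ (Fin n) → EuclideanSpace ℝ (Fin n),
      VarAn.IsLipschitzLocalization (VarAn.setInv (VarAn.geMap f φ)) ubar xbar σ →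
        ContDiffAt ℝ 1 σ ubar ∧
        VarAn.ReducedInverseFormula K A (fderiv ℝ σ ubar)) := by
  obtain ⟨hl1, hl2⟩ := hl
  have hΦ1 : ContDiffAt ℝ 1 Φ xbar := hΦ.of_le (by norm_num)
  set N := vectorSpan ℝ (VarAn.subdiff g (Φ xbar)) with hN
  have hinj : ∀ η ∈ N, (fderiv ℝ Φ xbar).adjoint η = 0 → η = 0 := by
    intro η hη h0
    have : η ∈ VarAn.coderiv (VarAn.subdiff g) (Φ xbar) lbar 0 ∩
        {y | (fderiv ℝ Φ xbar).adjoint y = 0} :=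
      ⟨VarAn.vectorSpan_subset_coderiv_subdiff hg hl2 hη, h0⟩
    rw [hsoqc] at this
    exact this
  obtain ⟨r, hr, hri⟩ := VarAn.exists_ball_multiplier hg hΦ1 hφ hl2 hinj (hl1 ▸ hnd)
  let Ksub : Submodule ℝ (EuclideanSpace ℝ (Fin n)) :=
    LinearMap.ker (N.orthogonalProjectionOnto ∘L fderiv ℝ Φ xbar : _ →L[ℝ] N).toLinearMap
  have hKmem : ∀ w, w ∈ Ksub ↔ N.orthogonalProjectionOnto (fderiv ℝ Φ xbar w) = 0 :=
    fun w => Iff.rfl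
  have hKsub : (Ksub : Set (EuclideanSpace ℝ (Fin n))) = K := by
    ext w
    rw [hK, ← hl1, VarAn.mem_criticalCone_iff hg hΦ1 hφ hN hinj hr hri]
    exact hKmem w
  have hG := VarAn.hasKKTGraph_geMap hg hΦ1 hφ hf.continuous.continuousAt hN hinj hr hri (f := f)
  have hA' : HasFDerivAt (fun x => f x + (fderiv ℝ Φ x).adjoint lbar) A xbar :=
    hA ▸ VarAn.hasFDerivAt_add_adjoint (hf.differentiable one_ne_zero xbar) hΦ lbar
  have hu : f xbar + (fderiv ℝ Φ xbar).adjoint lbar = ubar := by rw [hl1]; abel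
  have h23 := VarAn.inter_eq_zero_iff_add_eq_univ Ksub A
  rw [hKsub] at h23
  have h35 : A '' K + VarAn.perp K = Set.univ →
      ∃ σ : EuclideanSpace ℝ (Fin n) → EuclideanSpace ℝ (Fin n),
        VarAn.IsLipschitzLocalization (VarAn.setInv (VarAn.geMap f φ)) ubar xbar σ ∧
        ContDiffAt ℝ 1 σ ubar ∧ VarAn.ReducedInverseFormula K A (fderiv ℝ σ ubar) := by
    intro h3
    rw [← hKsub] at h3
    have hreg : ∀ w ∈ Ksub, A w ∈ Ksubᗮ → w = 0 :=
      fun w hw hAw => VarAn.eq_zero_of_add_eq_univ h3 hw hAw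
    obtain ⟨σ, hσ1, hσ2, hσ3⟩ := hG.exists_localization hf.contDiffAt hΦ hinj hA'
      fun w hw hAw => hreg w hw ((Submodule.mem_orthogonal' _ _).2 hAw)
    rw [hu] at hσ1 hσ2 hσ3
    refine ⟨σ, hσ1, hσ2, ?_⟩
    rw [← hKsub]
    exact VarAn.reducedInverseFormula_of_projected hreg (fun z => (hσ3 z).1)
      fun z => (Submodule.mem_orthogonal' _ _).2 (hσ3 z).2
  have h14 : VarAn.MetricallyRegular (VarAn.geMap f φ) xbar ubar →
      ∀ z, ∃ w, z ∈ VarAn.graphDeriv (VarAn.geMap f φ) xbar ubar w :=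
    fun h z => h.exists_mem_graphDeriv z
  have h43 : (∀ z, ∃ w, z ∈ VarAn.graphDeriv (VarAn.geMap f φ) xbar ubar w) →
      A '' K + VarAn.perp K = Set.univ := by
    intro h
    refine eq_univ_of_forall fun z => ?_
    obtain ⟨w, hw⟩ := h z
    rw [← hu] at hw
    obtain ⟨h1, h2⟩ := hG.of_mem_graphDeriv hΦ hA' hw
    rw [← hKsub, VarAn.perp_coe]
    exact ⟨A w, ⟨w, h1, rfl⟩, z - A w, (Submodule.mem_orthogonal' _ _).2 h2, by simp⟩
  refine ⟨?_, ⟨Ksub, hKsub⟩, ⟨fun h => ?_, fun h => h.metricallyRegular⟩, ?_, fun σ hσ => ?_⟩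
  · refine Subset.antisymm (fun l hl => ?_) (singleton_subset_iff.2 ⟨hl1, hl2⟩)
    refine sub_eq_zero.1 (hinj _ (vsub_mem_vectorSpan ℝ hl.2 hl2) ?_)
    rw [map_sub, hl.1, hl1, sub_self]
  · obtain ⟨σ, hσ, -⟩ := h35 (h43 (h14 h))
    exact ⟨σ, hσ⟩
  · tfae_have 1 → 4 := h14
    tfae_have 4 → 3 := h43
    tfae_have 2 ↔ 3 := h23
    tfae_have 3 → 5 := h35
    tfae_have 5 → 1 := fun ⟨σ, hσ, _⟩ =>
      VarAn.StronglyMetricallyRegular.metricallyRegular ⟨σ, hσ⟩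
    tfae_finish
  · have hmr : VarAn.MetricallyRegular (VarAn.geMap f φ) xbar ubar :=
      VarAn.StronglyMetricallyRegular.metricallyRegular ⟨σ, hσ⟩
    obtain ⟨τ, hτ1, hτ2, hτ3⟩ := h35 (h43 (h14 hmr))
    have heq := hσ.eventuallyEq hτ1
    refine ⟨hτ2.congr_of_eventuallyEq heq, ?_⟩
    rwa [heq.fderiv_eq]
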